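/- Let $K$ be a field and $v$ a (Krull) valuation on $K$, of arbitrary rank and possibly trivial, with valuation ring $\mathcal O_v$, value group $vK=v(K^\times)$ (written additively) and residue field $Kv$; no assumption is made on the characteristics of $K$ and $Kv$ (in particular, characteristic $2$ is allowed). A quadratic form of dimension $n$ over a field $F$ is a homogeneous polynomial of degree $2$ in $n$ variables over $F$; it is anisotropic if it has no zero in $F^n\setminus\{0\}$, and hyperbolic if it is isometric to an orthogonal sum of finitely many (possibly no) copies of $X_1X_2$. If $\mathrm{char}(F)\neq 2$, a form $\varphi$ is called a torsion form if $m\times\varphi=\varphi\perp\dots\perp\varphi$ is hyperbolic for some integer $m\geq 1$; if $\mathrm{char}(F)=2$, every form is called a torsion form. The general $u$-invariant is $$u(F)=\sup\{\dim\varphi \mid \varphi \text{ an anisotropic torsion form over } F\}\in\mathbb N\cup\{\infty\}.$$ The field $F$ is called nonreal if $-1$ is a sum of squares in $F$, and real otherwise. Denote by $\Sigma K^2$ the set of sums of squares in $K$. The index $[vK:2vK]$ is taken in $\mathbb N\cup\{\infty\}$, with the conventions $\lfloor\infty/2\rfloor=\infty$, $\infty\cdot 0=0$, and $\infty$ counted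 as even. Then $$u(K)\;\ge\;[vK:2vK]\cdot 2\left\lfloor \tfrac{u(Kv)}{2}\right\rfloor .$$ Moreover, $u(K)\ge [vK:2vK]\cdot u(Kv)$ holds under any one of the following conditions: (i) $K$ is nonreal; (ii) $Kv$ is real; (iii) $u(Kv)$ is even; (iv) $v(\Sigma K^2\setminus\{0\})\not\subseteq 2vK$. -/

import Mathlib

/-- The hyperbolic plane over `K`: the quadratic form `X₁X₂` in two variables. -/
def hyperbolicPlane (K : Type*) [Field K] : QuadraticForm K (K × K) :=
  QuadraticMap.linMulLin (LinearMap.fst K K K) (LinearMap.snd K K K)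

/-- The `m`-fold orthogonal sum `m × Q = Q ⟂ ... ⟂ Q`. -/
def orthogonalMultiple {K M : Type*} [Field K] [AddCommGroup M] [Module K M]
    (m : ℕ) (Q : QuadraticForm K M) : QuadraticForm K (Fin m → M) :=
  QuadraticMap.pi fun _ : Fin m => Q

/-- A quadratic form is hyperbolic if it is isometric to an orthogonal sum of finitely many
(possibly no) hyperbolic planes. -/
def IsHyperbolicForm {K M : Type*} [Field K] [AddCommGroup M] [Module K M]
    (Q : QuadraticForm K M) : Prop :=
  ∃ m : ℕ, QuadraticMap.Equivalent Q (orthogonalMultiple m (hyperbolicPlane K))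

/-- Torsion forms: in characteristic `2` every quadratic form is a torsion form; in characteristic
different from `2`, a form `Q` is torsion if `m × Q` is hyperbolic for some `m ≥ 1`. -/
def IsTorsionForm {K M : Type*} [Field K] [AddCommGroup M] [Module K M]
    (Q : QuadraticForm K M) : Prop :=
  CharP K 2 ∨ ∃ m : ℕ, 0 < m ∧ IsHyperbolicForm (orthogonalMultiple m Q)

/-- The general `u`-invariant of a field: the supremum in `ℕ ∪ {∞}` of the dimensions of the
anisotropic torsion forms. Quadratic forms of dimension `n`, that is, homogeneous polynomials of
degree `2` in `n` variables, are the quadratic forms on `Kⁿ`. -/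
noncomputable def uInvariant (K : Type*) [Field K] : ℕ∞ :=
  ⨆ (n : ℕ) (_ : ∃ Q : QuadraticForm K (Fin n → K), Q.Anisotropic ∧ IsTorsionForm Q), (n : ℕ∞)

/-- `⌊u / 2⌋` for `u ∈ ℕ ∪ {∞}`, where `⌊∞ / 2⌋ = ∞`. -/
def floorHalf (u : ℕ∞) : ℕ∞ :=
  ENat.map (fun n : ℕ => n / 2) u

namespace Valuation

variable {K Γ₀ : Type*} [Field K] [LinearOrderedCommGroupWithZero Γ₀] (v : Valuation K Γ₀)

/-- The value group `vK = v(Kˣ)`, written multiplicatively. -/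
def valueGroupK : Subgroup Γ₀ˣ :=
  (Units.map (v : K →* Γ₀)).range

/-- The valuation as a homomorphism `Kˣ → vK`. -/
def unitsValue : Kˣ →* v.valueGroupK :=
  (Units.map (v : K →* Γ₀)).rangeRestrict

/-- The subgroup `2vK` of `vK`: as `vK` is written multiplicatively, it consists of the squares. -/
def twoValueGroup : Subgroup v.valueGroupK :=
  (powMonoidHom 2 : v.valueGroupK →* v.valueGroupK).range

/-- The index `[vK : 2vK]` in `ℕ ∪ {∞}`. -/
noncomputable def indexTwo : ℕ∞ :=
  ENat.card (v.valueGroupK ⧸ v.twoValueGroup)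

/-- The residue field `Kv` of the valuation ring of `v`. -/
abbrev residueFieldK : Type _ :=
  IsLocalRing.ResidueField v.valuationSubring

end Valuation

/-!
The engine is Springer's argument. Let `Q` be a quadratic form over `K` with integral coefficients
whose reduction `q` over `Kv` is anisotropic, and let `t j` represent distinct classes of
`vK / 2vK`. The values of the summands `t j • Q` lie in distinct classes, so the orthogonal sum of
the `t j • Q` is anisotropic. More generally, if the totally isotropic subspaces of `q` have
dimension at most `r`, those of an orthogonal sum of `m` such multiples have dimension at most
`m * r` (`ReducesTo.finrank_le_of_isTotallyIsotropic`). What remains is to lift a torsion form over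
`Kv` to a torsion form over `K`.

* If `K` is nonreal or of characteristic `2`, every anisotropic form over `K` is torsion, so any
  lift will do.
* If a sum of squares `S` has value outside `2vK`, the classes of `vK / 2vK` come in pairs, and
  `Q ⟂ -S Q` is torsion for every `Q`.
* If `Kv` is nonreal, an anisotropic form over `Kv` contains an orthogonal sum of
  `⌊dim / 2⌋` binary forms, and a binary form can be lifted such that its discriminant is a sum of
  squares (`exists_lift_discriminant_isSumSq`), which makes the lift torsion. Here a single dimension
  may be lost.
* If `Kv` is real, a torsion form over `Kv` is Witt equivalent to an orthogonal sum of forms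
  `a (X² - s Y²)` with `s` a sum of squares (`exists_hasLagrangian_prod_blockForm`). These lift to
  torsion forms over `K`. The lift may be isotropic, but the bound for totally isotropic subspaces
  shows that its anisotropic part has at least the required dimension.

Torsion forms are handled through totally isotropic subspaces of half dimension (Lagrangians) of
their multiples: in characteristic different from `2` a nonsingular form is hyperbolic if and only
if it has a Lagrangian, and Lagrangians pass to `U^⊥ / U` for a totally isotropic `U`
(`IsTotallyIsotropic.exists_reduction`), which replaces Witt cancellation. They are produced by
matrices `T` with `Tᵀ T = s`, which exist for every sum of squares `s` (`IsSumSq.exists_similitude`).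
-/

open Module QuadraticMap

/-! ### Totally isotropic subspaces and Lagrangians -/

section TotallyIsotropic

variable {K V V' : Type*} [Field K] [AddCommGroup V] [Module K V] [AddCommGroup V'] [Module K V']

/-- A subspace on which the quadratic form `Q` vanishes identically. -/
def IsTotallyIsotropic (Q : QuadraticForm K V) (L : Submodule K V) : Prop :=
  ∀ x ∈ L, Q x = 0

lemma IsTotallyIsotropic.polar_eq_zero {Q : QuadraticForm K V} {L : Submodule K V}
    (h : IsTotallyIsotropic Q L) {x y : V} (hx : x ∈ L) (hy : y ∈ L) : polar Q x y = 0 := by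
  simp [polar, h x hx, h y hy, h _ (L.add_mem hx hy)]

/-- `Q` vanishes on a subspace of at least half the dimension of the whole space. For a form with
nondegenerate polar form the dimension of such a subspace is exactly one half. The notion is used
for finite-dimensional spaces only; otherwise `finrank` is `0` and the condition is empty. -/
def HasLagrangian (Q : QuadraticForm K V) : Prop :=
  ∃ L : Submodule K V, IsTotallyIsotropic Q L ∧ finrank K V ≤ 2 * finrank K L

/-- Some multiple `m × Q` with `m ≥ 1` has a Lagrangian. For a form with nondegenerate polar form
over a field of characteristic different from `2` this says that `Q` is a torsion form. -/
def IsWeaklyMetabolic (Q : QuadraticForm K V) : Prop :=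
  ∃ m : ℕ, 0 < m ∧ HasLagrangian (orthogonalMultiple m Q)

/-- The polar form of `Q` is nondegenerate. -/
def IsNonsingular (Q : QuadraticForm K V) : Prop :=
  ∀ x, (∀ y, polar Q x y = 0) → x = 0

lemma HasLagrangian.of_linearEquiv {Q : QuadraticForm K V} {Q' : QuadraticForm K V'}
    (e : V ≃ₗ[K] V') (he : ∀ x, Q' (e x) = Q x) (h : HasLagrangian Q) : HasLagrangian Q' := by
  obtain ⟨L, hL, hd⟩ := h
  refine ⟨L.map (e : V →ₗ[K] V'), ?_, ?_⟩
  · rintro _ ⟨x, hx, rfl⟩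
    exact (he x).trans (hL x hx)
  · rw [LinearEquiv.finrank_map_eq, ← e.finrank_eq]
    exact hd

/-- The subspace of the families with all entries in `L`. -/
def Submodule.power (L : Submodule K V) (ι : Type*) : Submodule K (ι → V) :=
  LinearMap.range (L.subtype.compLeft ι)

lemma Submodule.mem_power {L : Submodule K V} {ι : Type*} {x : ι → V} :
    x ∈ L.power ι ↔ ∀ i, x i ∈ L := by
  constructor
  · rintro ⟨y, rfl⟩ i
    exact (y i).2
  · intro h
    exact ⟨fun i => ⟨x i, h i⟩, rfl⟩

lemma Submodule.finrank_power [FiniteDimensional K V] (L : Submodule K V) (ι : Type*) [Fintype ι] :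
    finrank K (L.power ι) = Fintype.card ι * finrank K L := by
  rw [Submodule.power, LinearMap.finrank_range_of_inj, finrank_pi_fintype]
  · simp
  · intro x y h
    funext i
    exact Subtype.ext (congrFun h i)

lemma HasLagrangian.pi [FiniteDimensional K V] {Q : QuadraticForm K V} (h : HasLagrangian Q)
    (κ : Type*) [Fintype κ] : HasLagrangian (QuadraticMap.pi fun _ : κ => Q) := by
  obtain ⟨L, hL, hd⟩ := h
  refine ⟨L.power κ, ?_, ?_⟩
  · intro x hx
    rw [QuadraticMap.pi_apply]
    exact Finset.sum_eq_zero fun i _ => hL _ (Submodule.mem_power.1 hx i)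
  · rw [Submodule.finrank_power, finrank_pi_fintype]
    simp only [Finset.sum_const, smul_eq_mul, Finset.card_univ]
    nlinarith

lemma IsWeaklyMetabolic.of_fintype {Q : QuadraticForm K V} (ι : Type*) [Fintype ι] [Nonempty ι]
    (h : HasLagrangian (QuadraticMap.pi fun _ : ι => Q)) : IsWeaklyMetabolic Q := by
  refine ⟨Fintype.card ι, Fintype.card_pos, ?_⟩
  refine h.of_linearEquiv (LinearEquiv.funCongrLeft K V (Fintype.equivFin ι).symm) ?_
  intro x
  simp only [orthogonalMultiple, QuadraticMap.pi_apply, LinearEquiv.funCongrLeft_apply,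
    LinearMap.funLeft_apply]
  exact Equiv.sum_comp (Fintype.equivFin ι).symm (fun i => Q (x i))

lemma IsWeaklyMetabolic.of_linearEquiv {Q : QuadraticForm K V} {Q' : QuadraticForm K V'}
    (e : V ≃ₗ[K] V') (he : ∀ x, Q' (e x) = Q x) (h : IsWeaklyMetabolic Q) :
    IsWeaklyMetabolic Q' := by
  obtain ⟨m, hm, h⟩ := h
  refine ⟨m, hm, h.of_linearEquiv (LinearEquiv.piCongrRight fun _ : Fin m => e) ?_⟩
  intro x
  simp [orthogonalMultiple, QuadraticMap.pi_apply, he]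

/-- An orthogonal sum of multiples `t j • Q` is weakly metabolic if `Q` is. -/
lemma IsWeaklyMetabolic.pi_smul [FiniteDimensional K V] {Q : QuadraticForm K V}
    (h : IsWeaklyMetabolic Q) {J : Type*} [Fintype J] (t : J → K) :
    IsWeaklyMetabolic (QuadraticMap.pi fun j : J => t j • Q) := by
  obtain ⟨m, hm, L, hL, hd⟩ := h
  refine ⟨m, hm, ?_⟩
  let e : (J → Fin m → V) ≃ₗ[K] (Fin m → J → V) :=
    { toFun := fun x k j => x j k
      invFun := fun x j k => x k j
      map_add' := fun _ _ => rfl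
      map_smul' := fun _ _ => rfl
      left_inv := fun _ => rfl
      right_inv := fun _ => rfl }
  refine ⟨(L.power J).map (e : (J → Fin m → V) →ₗ[K] (Fin m → J → V)), ?_, ?_⟩
  · rintro _ ⟨x, hx, rfl⟩
    simp only [orthogonalMultiple, QuadraticMap.pi_apply, _root_.smul_apply, smul_eq_mul]
    rw [Finset.sum_comm]
    refine Finset.sum_eq_zero fun j _ => ?_
    have := hL _ (Submodule.mem_power.1 hx j)
    rw [orthogonalMultiple, QuadraticMap.pi_apply] at this
    rw [← Finset.mul_sum]
    exact mul_eq_zero_of_right _ this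
  · rw [LinearEquiv.finrank_map_eq, ← e.finrank_eq, Submodule.finrank_power, finrank_pi_fintype]
    simp only [Finset.sum_const, smul_eq_mul, Finset.card_univ]
    nlinarith

lemma IsNonsingular.pi {Q : QuadraticForm K V} (h : IsNonsingular Q) (ι : Type*) [Fintype ι] :
    IsNonsingular (QuadraticMap.pi fun _ : ι => Q) := by
  classical
  intro x hx
  funext i
  refine h _ fun y => ?_
  have := hx (Pi.single i y)
  rw [Ring.polar_pi, Finset.sum_eq_single i] at this
  · simpa using this
  · intro j _ hj
    simp [Pi.single_eq_of_ne hj]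
  · simp

lemma IsNonsingular.pi_smul {Q : QuadraticForm K V} (h : IsNonsingular Q) {ι : Type*} [Fintype ι]
    {t : ι → K} (ht : ∀ i, t i ≠ 0) : IsNonsingular (QuadraticMap.pi fun i : ι => t i • Q) := by
  classical
  intro x hx
  funext i
  refine h _ fun y => ?_
  have := hx (Pi.single i y)
  rw [Ring.polar_pi, Finset.sum_eq_single i] at this
  · simpa [FunLike.coe_smul, QuadraticMap.polar_smul, ht i] using this
  · intro j _ hj
    rw [Pi.single_eq_of_ne hj]
    exact QuadraticMap.polar_zero_right (t j • Q) _
  · simp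

lemma QuadraticMap.Anisotropic.isNonsingular {Q : QuadraticForm K V} (h : Q.Anisotropic)
    (h2 : (2 : K) ≠ 0) : IsNonsingular Q := by
  intro x hx
  refine h x ?_
  have := hx x
  rw [QuadraticMap.polar_self, two_nsmul, ← two_mul] at this
  exact (mul_eq_zero.1 this).resolve_left h2

end TotallyIsotropic

/-! ### Reduction along a totally isotropic subspace -/

section Reduction

variable {K V V' : Type*} [Field K] [AddCommGroup V] [Module K V] [AddCommGroup V'] [Module K V']

/-- The orthogonal space of `U` with respect to the polar form of `Q`. -/
abbrev QuadraticForm.perp (Q : QuadraticForm K V) (U : Submodule K V) : Submodule K V :=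
  LinearMap.BilinForm.orthogonal Q.polarBilin U

lemma QuadraticForm.mem_perp {Q : QuadraticForm K V} {U : Submodule K V} {x : V} :
    x ∈ QuadraticForm.perp Q U ↔ ∀ u ∈ U, polar Q u x = 0 := Iff.rfl

lemma IsNonsingular.finrank_perp [FiniteDimensional K V] {Q : QuadraticForm K V}
    (h : IsNonsingular Q) (U : Submodule K V) :
    finrank K U + finrank K (QuadraticForm.perp Q U) = finrank K V := by
  have := LinearMap.BilinForm.finrank_add_finrank_orthogonal' (B := Q.polarBilin) U
  have hker : LinearMap.ker Q.polarBilin = ⊥ := by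
    rw [LinearMap.ker_eq_bot']
    intro x hx
    exact h x fun y => LinearMap.congr_fun hx y
  rw [hker, inf_bot_eq, finrank_bot, add_zero] at this
  exact this

/-- If `L` is totally isotropic, passing from `L` to `L ⊓ U^⊥` costs only `dim U - dim (L ⊓ U)`
dimensions, since `L ⊓ U` is already orthogonal to `L`. -/
lemma IsTotallyIsotropic.finrank_add_finrank_inf_le [FiniteDimensional K V]
    {Q : QuadraticForm K V} {L : Submodule K V} (hL : IsTotallyIsotropic Q L)
    (U : Submodule K V) :
    finrank K L + finrank K (L ⊓ U : Submodule K V) ≤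
      finrank K (L ⊓ QuadraticForm.perp Q U : Submodule K V) + finrank K U := by
  have h1 := LinearMap.BilinForm.finrank_add_finrank_orthogonal' (B := Q.polarBilin) U
  have h2 := LinearMap.BilinForm.finrank_add_finrank_orthogonal' (B := Q.polarBilin) (L ⊓ U)
  have h3 := Submodule.finrank_sup_add_finrank_inf_eq L (QuadraticForm.perp Q U)
  have h4 : L ⊔ QuadraticForm.perp Q U ≤ QuadraticForm.perp Q (L ⊓ U) := by
    refine sup_le (fun x hx => ?_) (LinearMap.BilinForm.orthogonal_le inf_le_right)
    exact QuadraticForm.mem_perp.2 fun u hu => hL.polar_eq_zero hu.1 hx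
  have h5 := Submodule.finrank_mono h4
  have h6 : finrank K (L ⊓ U ⊓ LinearMap.ker Q.polarBilin : Submodule K V) ≤
      finrank K (U ⊓ LinearMap.ker Q.polarBilin : Submodule K V) :=
    Submodule.finrank_mono (inf_le_inf_right _ inf_le_right)
  simp only [QuadraticForm.perp] at *
  omega

/-- Reduction of totally isotropic subspaces along `U^⊥ / U`: here `g` identifies `V'` with a
complement of the totally isotropic subspace `U` in `U^⊥`. -/
lemma IsTotallyIsotropic.exists_reduction [FiniteDimensional K V] [FiniteDimensional K V']
    {Q : QuadraticForm K V} {Q' : QuadraticForm K V'} {U L : Submodule K V}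
    (hU : IsTotallyIsotropic Q U) (g : V' →ₗ[K] V) (hg : ∀ y, Q (g y) = Q' y)
    (hortho : ∀ u ∈ U, ∀ y, polar Q u (g y) = 0)
    (hperp : ∀ x ∈ QuadraticForm.perp Q U, ∃ u ∈ U, ∃ y, x = u + g y)
    (hL : IsTotallyIsotropic Q L) :
    ∃ L' : Submodule K V', IsTotallyIsotropic Q' L' ∧
      finrank K L ≤ finrank K L' + finrank K U := by
  refine ⟨(L ⊓ QuadraticForm.perp Q U ⊔ U).comap g, ?_, ?_⟩
  · intro y hy
    obtain ⟨l, hl, u, hu, h⟩ := Submodule.mem_sup.1 hy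
    have hl' : l = -u + g y := by rw [← h]; abel
    have hq : Q (-u + g y) = 0 := hl' ▸ hL l hl.1
    rw [QuadraticMap.map_add Q, hU _ (U.neg_mem hu), hortho _ (U.neg_mem hu), hg] at hq
    simpa using hq
  · have h1 := hL.finrank_add_finrank_inf_le U
    have h2 := Submodule.finrank_sup_add_finrank_inf_eq (L ⊓ QuadraticForm.perp Q U) U
    have h3 : L ⊓ QuadraticForm.perp Q U ⊔ U ≤
        U ⊔ ((L ⊓ QuadraticForm.perp Q U ⊔ U).comap g).map g := by
      refine sup_le (fun x hx => ?_) le_sup_left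
      obtain ⟨u, hu, y, rfl⟩ := hperp x hx.2
      refine Submodule.add_mem_sup hu ⟨y, ?_, rfl⟩
      rw [SetLike.mem_coe, Submodule.mem_comap]
      have : g y = (u + g y) + -u := by abel
      rw [this]
      exact Submodule.add_mem_sup hx (U.neg_mem hu)
    have h4 := Submodule.finrank_mono h3
    have h5 := Submodule.finrank_add_le_finrank_add_finrank U
      (((L ⊓ QuadraticForm.perp Q U ⊔ U).comap g).map g)
    have h6 := Submodule.finrank_map_le g ((L ⊓ QuadraticForm.perp Q U ⊔ U).comap g)
    have h7 : finrank K (L ⊓ QuadraticForm.perp Q U ⊓ U : Submodule K V) ≤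
        finrank K (L ⊓ U : Submodule K V) :=
      Submodule.finrank_mono (inf_le_inf_right _ inf_le_left)
    omega

/-- A Witt decomposition: `U` is a maximal totally isotropic subspace and `W` is an anisotropic
complement of `U` in `U^⊥`. -/
lemma IsNonsingular.exists_anisotropic_part [FiniteDimensional K V] {Q : QuadraticForm K V}
    (h : IsNonsingular Q) :
    ∃ U W : Submodule K V, IsTotallyIsotropic Q U ∧ (Q.comp W.subtype).Anisotropic ∧
      (∀ u ∈ U, ∀ w ∈ W, polar Q u w = 0) ∧
      (∀ x ∈ QuadraticForm.perp Q U, ∃ u ∈ U, ∃ w ∈ W, x = u + w) ∧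
      finrank K V = finrank K W + 2 * finrank K U ∧ Disjoint U W ∧
      ∀ U', IsTotallyIsotropic Q U' → finrank K U' ≤ finrank K U := by
  let P : ℕ → Prop := fun d => ∃ U : Submodule K V, IsTotallyIsotropic Q U ∧ finrank K U = d
  classical
  have hP0 : P 0 := ⟨⊥, fun x hx => by simp [(Submodule.mem_bot K).1 hx], finrank_bot K V⟩
  obtain ⟨U, hU, hdU⟩ := Nat.findGreatest_spec (P := P) (Nat.zero_le (finrank K V)) hP0
  have hmax : ∀ U', IsTotallyIsotropic Q U' → finrank K U' ≤ finrank K U := fun U' hU' =>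
    hdU ▸ Nat.le_findGreatest (Submodule.finrank_le U') ⟨U', hU', rfl⟩
  have hUperp : U ≤ QuadraticForm.perp Q U := fun x hx =>
    QuadraticForm.mem_perp.2 fun u hu => hU.polar_eq_zero hu hx
  obtain ⟨C, hC⟩ := Submodule.exists_isCompl U
  have hdisj : Disjoint U (C ⊓ QuadraticForm.perp Q U) := hC.disjoint.mono_right inf_le_left
  have hsup : U ⊔ C ⊓ QuadraticForm.perp Q U = QuadraticForm.perp Q U := by
    rw [← sup_inf_assoc_of_le _ hUperp, hC.sup_eq_top, top_inf_eq]
  refine ⟨U, C ⊓ QuadraticForm.perp Q U, hU, ?_, ?_, ?_, ?_, hdisj, hmax⟩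
  · rintro ⟨w, hw⟩ hQ
    by_contra hne
    have hne' : w ≠ 0 := fun h0 => hne (Subtype.ext h0)
    have hTI : IsTotallyIsotropic Q (U ⊔ K ∙ w) := by
      intro x hx
      obtain ⟨u, hu, z, hz, rfl⟩ := Submodule.mem_sup.1 hx
      obtain ⟨c, rfl⟩ := Submodule.mem_span_singleton.1 hz
      have hQ' : Q w = 0 := hQ
      rw [QuadraticMap.map_add Q, hU u hu, QuadraticMap.map_smul, hQ', polar_smul_right,
        QuadraticForm.mem_perp.1 hw.2 u hu]
      simp
    have h1 := hmax _ hTI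
    have h2 := Submodule.finrank_sup_add_finrank_inf_eq U (K ∙ w)
    have h3 : U ⊓ (K ∙ w) = ⊥ := by
      rw [← disjoint_iff]
      exact hdisj.mono_right ((Submodule.span_singleton_le_iff_mem _ _).2 hw)
    rw [h3, finrank_bot, finrank_span_singleton hne'] at h2
    omega
  · exact fun u hu w hw => QuadraticForm.mem_perp.1 hw.2 u hu
  · intro x hx
    rw [← hsup] at hx
    obtain ⟨u, hu, w, hw, rfl⟩ := Submodule.mem_sup.1 hx
    exact ⟨u, hu, w, hw, rfl⟩
  · have h1 := Submodule.finrank_sup_add_finrank_inf_eq U (C ⊓ QuadraticForm.perp Q U)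
    rw [hsup, hdisj.eq_bot, finrank_bot] at h1
    have h2 := h.finrank_perp U
    omega

/-- The anisotropic part of a weakly metabolic form is weakly metabolic. -/
lemma IsWeaklyMetabolic.comp_subtype [FiniteDimensional K V] {Q : QuadraticForm K V}
    (h : IsWeaklyMetabolic Q) {U W : Submodule K V} (hU : IsTotallyIsotropic Q U)
    (hortho : ∀ u ∈ U, ∀ w ∈ W, polar Q u w = 0)
    (hperp : ∀ x ∈ QuadraticForm.perp Q U, ∃ u ∈ U, ∃ w ∈ W, x = u + w)
    (hdim : finrank K V = finrank K W + 2 * finrank K U) :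
    IsWeaklyMetabolic (Q.comp W.subtype) := by
  obtain ⟨m, hm, L, hL, hd⟩ := h
  refine ⟨m, hm, ?_⟩
  have hUm : IsTotallyIsotropic (orthogonalMultiple m Q) (U.power (Fin m)) := by
    intro x hx
    rw [orthogonalMultiple, QuadraticMap.pi_apply]
    exact Finset.sum_eq_zero fun i _ => hU _ (Submodule.mem_power.1 hx i)
  have hred := hUm.exists_reduction
    (Q' := orthogonalMultiple m (Q.comp W.subtype)) (W.subtype.compLeft (Fin m))
    (fun y => by simp [orthogonalMultiple, QuadraticMap.pi_apply])
    (fun u hu y => by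
      rw [orthogonalMultiple, Ring.polar_pi]
      exact Finset.sum_eq_zero fun i _ => hortho _ (Submodule.mem_power.1 hu i) _ (y i).2)
    (fun x hx => by
      have hx' : ∀ i, ∃ u ∈ U, ∃ w ∈ W, x i = u + w := by
        intro i
        refine hperp _ (QuadraticForm.mem_perp.2 fun u hu => ?_)
        have := QuadraticForm.mem_perp.1 hx (Pi.single i u) (Submodule.mem_power.2 fun j => by
          by_cases hj : j = i
          · subst hj; simpa using hu
          · simp [Pi.single_eq_of_ne hj])
        rw [orthogonalMultiple, Ring.polar_pi, Finset.sum_eq_single i] at this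
        · simpa using this
        · intro j _ hj
          simp [Pi.single_eq_of_ne hj]
        · simp
      choose u hu w hw huw using hx'
      exact ⟨u, Submodule.mem_power.2 hu, fun i => ⟨w i, hw i⟩, funext huw⟩) hL
  obtain ⟨L', hL', hd'⟩ := hred
  refine ⟨L', hL', ?_⟩
  rw [Submodule.finrank_power] at hd'
  rw [finrank_pi_fintype] at hd ⊢
  simp only [Finset.sum_const, smul_eq_mul, Finset.card_univ, Fintype.card_fin] at *
  nlinarith

end Reduction

/-! ### Hyperbolic and torsion forms -/

section Hyperbolic

variable {K V V' : Type*} [Field K] [AddCommGroup V] [Module K V] [AddCommGroup V'] [Module K V']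

lemma IsHyperbolicForm.hasLagrangian {Q : QuadraticForm K V} (h : IsHyperbolicForm Q) :
    HasLagrangian Q := by
  obtain ⟨m, ⟨e⟩⟩ := h
  refine HasLagrangian.of_linearEquiv e.symm.toLinearEquiv (fun x => e.symm.map_app x) ?_
  refine HasLagrangian.pi (Q := hyperbolicPlane K)
    ⟨LinearMap.range (LinearMap.inl K K K), ?_, ?_⟩ (Fin m)
  · rintro _ ⟨x, rfl⟩
    simp [hyperbolicPlane]
  · rw [LinearMap.finrank_range_of_inj LinearMap.inl_injective]
    simp

/-- Over a field of characteristic different from `2`, a nonsingular form with a Lagrangian is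
hyperbolic: a basis `e` of the Lagrangian has a dual family `f` for the polar form, and subtracting
from `f j` half of its products with the other `f i` makes the family `f` totally isotropic. -/
lemma HasLagrangian.isHyperbolicForm [FiniteDimensional K V] {Q : QuadraticForm K V}
    (h : HasLagrangian Q) (h2 : (2 : K) ≠ 0) (hQ : IsNonsingular Q) : IsHyperbolicForm Q := by
  obtain ⟨L, hL, hd⟩ := h
  set B := Q.polarBilin with hB
  have hsymm : ∀ x y, B x y = B y x := fun x y => polar_comm Q x y
  let e := finBasis K L
  have hnd : B.Nondegenerate := by
    refine ⟨fun x hx => hQ x hx, fun x hx => hQ x fun y => ?_⟩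
    rw [polar_comm]; exact hx y
  have hf : ∀ j, ∃ f : V, ∀ i, B f (e i) = if i = j then 1 else 0 := by
    intro j
    obtain ⟨φ, hφ⟩ := LinearMap.exists_extend (e.coord j)
    obtain ⟨f, hf⟩ := (LinearMap.BilinForm.toDual B hnd).surjective φ
    refine ⟨f, fun i => ?_⟩
    rw [← LinearMap.BilinForm.toDual_def (b := hnd), hf]
    have := LinearMap.congr_fun hφ (e i)
    simpa [Finsupp.single_apply] using this
  choose f hf using hf
  have hee : ∀ i j, B (e i) (e j) = 0 := fun i j => hL.polar_eq_zero (e i).2 (e j).2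
  let f' : Fin (finrank K L) → V := fun j => f j - ∑ i, (2⁻¹ * B (f i) (f j)) • (e i : V)
  have hef' : ∀ i j, B (e i) (f' j) = if i = j then 1 else 0 := by
    intro i j
    simp only [f', map_sub, map_sum, map_smul, hee, smul_zero, Finset.sum_const_zero, sub_zero]
    rw [hsymm, hf]
  have hff' : ∀ i j, B (f' i) (f' j) = 0 := by
    intro i j
    have h1 : ∀ y, B (f' i) y = B (f i) y - ∑ k, (2⁻¹ * B (f k) (f i)) * B (e k) y := by
      intro y
      simp only [f', map_sub, map_sum, map_smul, LinearMap.sub_apply, LinearMap.sum_apply,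
        LinearMap.smul_apply, smul_eq_mul]
    rw [h1]
    simp only [hef', mul_ite, mul_one, mul_zero, Finset.sum_ite_eq', Finset.mem_univ, if_true]
    simp only [f', map_sub, map_sum, map_smul, hf, smul_eq_mul, mul_ite, mul_one, mul_zero,
      Finset.sum_ite_eq', Finset.mem_univ, if_true]
    rw [hsymm (f j) (f i)]
    field_simp
    ring
  let g : (Fin (finrank K L) → K × K) →ₗ[K] V :=
    { toFun := fun p => ∑ j, ((p j).1 • (e j : V) + (p j).2 • f' j)
      map_add' := fun p q => by
        rw [← Finset.sum_add_distrib]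
        refine Finset.sum_congr rfl fun j _ => ?_
        simp only [Pi.add_apply, Prod.fst_add, Prod.snd_add, add_smul]
        abel
      map_smul' := fun c p => by
        simp [Finset.smul_sum, mul_smul] }
  have hgB : ∀ p q, B (g p) (g q) = ∑ j, ((p j).1 * (q j).2 + (p j).2 * (q j).1) := by
    intro p q
    simp only [g, LinearMap.coe_mk, AddHom.coe_mk, map_sum, map_add, map_smul,
      LinearMap.sum_apply, LinearMap.add_apply, LinearMap.smul_apply, smul_eq_mul, hee, hef',
      hff', hsymm (f' _) (e _)]
    simp [Finset.sum_add_distrib, add_comm, mul_comm]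
  have hgQ : ∀ p, Q (g p) = orthogonalMultiple _ (hyperbolicPlane K) p := by
    intro p
    have h1 := hgB p p
    have h3 : B (g p) (g p) = 2 * Q (g p) := by
      rw [hB, polarBilin_apply_apply, polar_self, two_nsmul, two_mul]
    rw [h3] at h1
    have h4 : (∑ j, ((p j).1 * (p j).2 + (p j).2 * (p j).1)) = 2 * ∑ j, (p j).1 * (p j).2 := by
      rw [Finset.mul_sum]
      exact Finset.sum_congr rfl fun j _ => by ring
    rw [h4] at h1
    rw [mul_left_cancel₀ h2 h1]
    simp [orthogonalMultiple, QuadraticMap.pi_apply, hyperbolicPlane]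
  have hginj : Function.Injective g := by
    rw [← LinearMap.ker_eq_bot, LinearMap.ker_eq_bot']
    intro p hp
    funext j
    have h1 := hgB p (Pi.single j (0, 1))
    have h3 := hgB p (Pi.single j (1, 0))
    rw [hp, map_zero, LinearMap.zero_apply, Finset.sum_eq_single j] at h1 h3
    · simp only [Pi.single_eq_same, mul_one, mul_zero, add_zero, zero_add] at h1 h3
      exact Prod.ext h1.symm h3.symm
    all_goals first
      | (intro i _ hi; simp [Pi.single_eq_of_ne hi])
      | simp
  have hdim : finrank K (Fin (finrank K L) → K × K) = finrank K V := by
    refine le_antisymm (LinearMap.finrank_le_finrank_of_injective hginj) (hd.trans ?_)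
    rw [finrank_pi_fintype]
    simp [mul_comm]
  refine ⟨finrank K L, ⟨QuadraticMap.IsometryEquiv.symm
    ⟨LinearEquiv.ofInjectiveOfFinrankEq g hginj hdim, fun p => ?_⟩⟩⟩
  exact hgQ p

lemma IsTorsionForm.isWeaklyMetabolic {Q : QuadraticForm K V} (h : IsTorsionForm Q)
    (h2 : (2 : K) ≠ 0) : IsWeaklyMetabolic Q := by
  rcases h with h | ⟨m, hm, h⟩
  · exact absurd (CharTwo.two_eq_zero (R := K)) h2
  · exact ⟨m, hm, h.hasLagrangian⟩

/-- The dimension of a weakly metabolic anisotropic form over a field of characteristic different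
from `2` is a lower bound of the `u`-invariant. -/
lemma IsWeaklyMetabolic.finrank_le_uInvariant [FiniteDimensional K V] {Q : QuadraticForm K V}
    (h : IsWeaklyMetabolic Q) (h2 : (2 : K) ≠ 0) (hQ : Q.Anisotropic) :
    (finrank K V : ℕ∞) ≤ uInvariant K := by
  let e : (Fin (finrank K V) → K) ≃ₗ[K] V := (finBasis K V).equivFun.symm
  have ha : (Q.comp (e : (Fin (finrank K V) → K) →ₗ[K] V)).Anisotropic := by
    intro x hx
    exact e.map_eq_zero_iff.1 (hQ _ hx)
  refine le_iSup₂_of_le (finrank K V) ⟨Q.comp (e : (Fin (finrank K V) → K) →ₗ[K] V), ha, ?_⟩ le_rfl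
  obtain ⟨m, hm, h'⟩ := h.of_linearEquiv
    (Q' := Q.comp (e : (Fin (finrank K V) → K) →ₗ[K] V)) e.symm (fun x => by simp)
  exact Or.inr ⟨m, hm, h'.isHyperbolicForm h2 ((ha.isNonsingular h2).pi _)⟩

lemma QuadraticMap.Anisotropic.finrank_le_uInvariant [CharP K 2] [FiniteDimensional K V]
    {Q : QuadraticForm K V} (hQ : Q.Anisotropic) : (finrank K V : ℕ∞) ≤ uInvariant K := by
  let e : (Fin (finrank K V) → K) ≃ₗ[K] V := (finBasis K V).equivFun.symm
  refine le_iSup₂_of_le (finrank K V) ⟨Q.comp (e : (Fin (finrank K V) → K) →ₗ[K] V), ?_,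
    Or.inl inferInstance⟩ le_rfl
  intro x hx
  exact e.map_eq_zero_iff.1 (hQ _ hx)

end Hyperbolic

/-! ### Similitudes whose multiplier is a sum of squares -/

section Similitude

open scoped Kronecker

variable {R : Type*} [CommRing R]

/-- A sum of squares is the multiplier of a square matrix that is a similitude of the standard form.
Adding the square `a²` doubles the size: replace `T` by `[[T, -a], [a, Tᵀ]]`. -/
lemma IsSumSq.exists_similitude {s : R} (h : IsSumSq s) :
    ∃ (ι : Type) (_ : Fintype ι) (_ : DecidableEq ι) (_ : Nonempty ι) (T : Matrix ι ι R),
      T.transpose * T = s • (1 : Matrix ι ι R) ∧ T * T.transpose = s • (1 : Matrix ι ι R) := by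
  induction h with
  | zero => exact ⟨Unit, inferInstance, inferInstance, inferInstance, 0, by simp, by simp⟩
  | @sq_add a s hs ih =>
    obtain ⟨ι, _, _, _, T, h1, h2⟩ := ih
    refine ⟨ι ⊕ ι, inferInstance, inferInstance, inferInstance,
      Matrix.fromBlocks T (-(a • 1)) (a • 1) T.transpose, ?_, ?_⟩
    · rw [Matrix.fromBlocks_transpose, Matrix.fromBlocks_multiply, ← Matrix.fromBlocks_one,
        Matrix.fromBlocks_smul]
      congr 1
      · simp [h1, add_smul, mul_smul, add_comm]
      · simp
      · simp
      · simp [h2, add_smul, mul_smul]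
    · rw [Matrix.fromBlocks_transpose, Matrix.fromBlocks_multiply, ← Matrix.fromBlocks_one,
        Matrix.fromBlocks_smul]
      congr 1
      · simp [h2, add_smul, mul_smul, add_comm]
      · simp
      · simp
      · simp [h1, add_smul, mul_smul]

/-- Finitely many sums of squares are multipliers of similitudes of one common size. -/
lemma exists_similitudes {n : Type*} [Finite n] {σ : n → R} (h : ∀ i, IsSumSq (σ i)) :
    ∃ (ι : Type) (_ : Fintype ι) (_ : DecidableEq ι) (_ : Nonempty ι),
      ∀ i, ∃ T : Matrix ι ι R, T.transpose * T = σ i • (1 : Matrix ι ι R) := by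
  classical
  have := Fintype.ofFinite n
  suffices H : ∀ S : Finset n, ∃ (ι : Type) (_ : Fintype ι) (_ : DecidableEq ι) (_ : Nonempty ι),
      ∀ i ∈ S, ∃ T : Matrix ι ι R, T.transpose * T = σ i • (1 : Matrix ι ι R) by
    simpa using H Finset.univ
  intro S
  induction S using Finset.induction_on with
  | empty => exact ⟨Unit, inferInstance, inferInstance, inferInstance, by simp⟩
  | insert j S _ ih =>
    obtain ⟨ι, _, _, _, hι⟩ := ih
    obtain ⟨κ, _, _, _, T, hT, -⟩ := (h j).exists_similitude
    refine ⟨κ × ι, inferInstance, inferInstance, inferInstance, fun i hi => ?_⟩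
    rcases Finset.mem_insert.1 hi with rfl | hi
    · refine ⟨T ⊗ₖ (1 : Matrix ι ι R), ?_⟩
      rw [← Matrix.kroneckerMap_transpose, ← Matrix.mul_kronecker_mul, hT]
      simp [Matrix.smul_kronecker]
    · obtain ⟨T', hT'⟩ := hι i hi
      refine ⟨(1 : Matrix κ κ R) ⊗ₖ T', ?_⟩
      rw [← Matrix.kroneckerMap_transpose, ← Matrix.mul_kronecker_mul, hT']
      simp [Matrix.kronecker_smul]

lemma Matrix.sum_mulVec_sq_of_transpose_mul_self {ι : Type*} [Fintype ι] [DecidableEq ι]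
    {T : Matrix ι ι R} {s : R} (h : T.transpose * T = s • (1 : Matrix ι ι R)) (y : ι → R) :
    ∑ k, (T.mulVec y) k ^ 2 = s * ∑ k, y k ^ 2 := by
  have h1 : T.mulVec y ⬝ᵥ T.mulVec y = s * (y ⬝ᵥ y) := by
    rw [Matrix.dotProduct_mulVec, ← Matrix.mulVec_transpose, Matrix.mulVec_mulVec, h,
      Matrix.smul_mulVec, Matrix.one_mulVec, smul_dotProduct, smul_eq_mul]
  simpa [dotProduct, _root_.sq] using h1

end Similitude

/-! ### Orthogonal sums of binary forms -/

section BlockForm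

variable {R n : Type*} [CommRing R] [Fintype n]

/-- The orthogonal sum of the binary forms `a i X² + b i XY + c i Y²`. The variables `X` are indexed
by `Sum.inl` and the variables `Y` by `Sum.inr`. -/
def blockForm (a b c : n → R) : QuadraticForm R (n ⊕ n → R) :=
  ∑ i, (a i • linMulLin (LinearMap.proj (Sum.inl i)) (LinearMap.proj (Sum.inl i)) +
    b i • linMulLin (LinearMap.proj (Sum.inl i)) (LinearMap.proj (Sum.inr i)) +
    c i • linMulLin (LinearMap.proj (Sum.inr i)) (LinearMap.proj (Sum.inr i)))

lemma blockForm_apply (a b c : n → R) (x : n ⊕ n → R) :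
    blockForm a b c x = ∑ i, (a i * x (Sum.inl i) ^ 2 + b i * (x (Sum.inl i) * x (Sum.inr i)) +
      c i * x (Sum.inr i) ^ 2) := by
  simp [blockForm, _root_.sq]

variable {K : Type*} [Field K]

/-- A sum of binary forms whose discriminants are sums of squares is weakly metabolic: up to the
factor `4 a` such a binary form is `(2aX + bY)² - DY²`, and similitudes with multiplier `D` provide
a Lagrangian of a multiple of it. -/
lemma isWeaklyMetabolic_blockForm {a b c : n → K} (h2 : (2 : K) ≠ 0) (ha : ∀ i, a i ≠ 0)
    (hD : ∀ i, IsSumSq (b i ^ 2 - 4 * a i * c i)) : IsWeaklyMetabolic (blockForm a b c) := by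
  obtain ⟨ι, _, _, _, hT⟩ := exists_similitudes hD
  choose T hT using hT
  refine IsWeaklyMetabolic.of_fintype ι ?_
  let g : (ι → n → K) →ₗ[K] (ι → n ⊕ n → K) :=
    { toFun := fun y k => Sum.elim
        (fun i => (2 * a i)⁻¹ * ((T i).mulVec (fun l => y l i) k - b i * y k i)) (fun i => y k i)
      map_add' := fun y z => by
        funext k i
        rcases i with i | i
        · have := congrFun (Matrix.mulVec_add (T i) (fun l => y l i) fun l => z l i) k
          rw [Pi.add_apply] at this
          simp only [Sum.elim_inl, Pi.add_apply]
          rw [mul_sub, mul_sub, mul_sub]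
          linear_combination (2 * a i)⁻¹ * this
        · rfl
      map_smul' := fun r y => by
        funext k i
        rcases i with i | i
        · have := congrFun (Matrix.mulVec_smul (T i) r fun l => y l i) k
          rw [Pi.smul_apply, smul_eq_mul] at this
          simp only [Sum.elim_inl, Pi.smul_apply, smul_eq_mul, RingHom.id_apply]
          linear_combination (2 * a i)⁻¹ * this
        · rfl }
  have hg : Function.Injective g := by
    intro y z h
    funext k i
    exact congrFun (congrFun h k) (Sum.inr i)
  refine ⟨LinearMap.range g, ?_, ?_⟩
  · rintro _ ⟨y, rfl⟩
    simp only [QuadraticMap.pi_apply, blockForm_apply]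
    rw [Finset.sum_comm]
    refine Finset.sum_eq_zero fun i _ => ?_
    have h4 : ∀ k, a i * (g y k (Sum.inl i)) ^ 2 + b i * (g y k (Sum.inl i) * g y k (Sum.inr i)) +
        c i * (g y k (Sum.inr i)) ^ 2 = (4 * a i)⁻¹ * (((T i).mulVec (fun l => y l i) k) ^ 2 -
          (b i ^ 2 - 4 * a i * c i) * y k i ^ 2) := by
      intro k
      have h4 : (4 : K) ≠ 0 := by
        have : (4 : K) = 2 * 2 := by norm_num
        rw [this]
        exact mul_ne_zero h2 h2
      have := ha i
      simp only [g, LinearMap.coe_mk, AddHom.coe_mk, Sum.elim_inl, Sum.elim_inr]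
      field_simp
      ring
    simp only [h4]
    rw [← Finset.mul_sum, Finset.sum_sub_distrib, ← Finset.mul_sum,
      Matrix.sum_mulVec_sq_of_transpose_mul_self (hT i), sub_self, mul_zero]
  · rw [LinearMap.finrank_range_of_inj hg]
    simp only [finrank_pi_fintype, finrank_self, Finset.sum_const, smul_eq_mul, Finset.card_univ,
      Fintype.card_sum, mul_one]
    apply le_of_eq
    ring

lemma isNonsingular_blockForm {a c : n → K} (h2 : (2 : K) ≠ 0) (ha : ∀ i, a i ≠ 0)
    (hc : ∀ i, c i ≠ 0) : IsNonsingular (blockForm a 0 c) := by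
  classical
  intro x hx
  have key : ∀ y, polar (blockForm a 0 c) x y =
      ∑ i, (2 * (a i * x (Sum.inl i)) * y (Sum.inl i) +
        2 * (c i * x (Sum.inr i)) * y (Sum.inr i)) := by
    intro y
    simp only [polar, blockForm_apply, Pi.zero_apply, Pi.add_apply]
    rw [← Finset.sum_sub_distrib, ← Finset.sum_sub_distrib]
    exact Finset.sum_congr rfl fun i _ => by ring
  funext i
  have h := hx (Pi.single i 1)
  rw [key] at h
  rcases i with i | i
  · rw [Finset.sum_eq_single i] at h
    · simpa [h2, ha i] using h
    · intro j _ hj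
      simp [hj]
    · simp
  · rw [Finset.sum_eq_single i] at h
    · simpa [h2, hc i] using h
    · intro j _ hj
      simp [hj]
    · simp

end BlockForm

/-! ### Witt equivalence and totally isotropic subspaces -/

section AnisotropicWitt

variable {K V V' : Type*} [Field K] [AddCommGroup V] [Module K V] [AddCommGroup V'] [Module K V']

lemma HasLagrangian.of_injective {Q : QuadraticForm K V} {Q' : QuadraticForm K V'}
    (f : V →ₗ[K] V') (hf : Function.Injective f) (hQ : ∀ x, Q' (f x) = Q x)
    (hd : finrank K V' ≤ finrank K V) (h : HasLagrangian Q) : HasLagrangian Q' := by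
  obtain ⟨L, hL, hdL⟩ := h
  refine ⟨L.map f, ?_, ?_⟩
  · rintro _ ⟨x, hx, rfl⟩
    exact (hQ x).trans (hL x hx)
  · rw [(Submodule.equivMapOfInjective f hf L).finrank_eq.symm]
    exact hd.trans hdL

/-- If the anisotropic form `Q` is Witt equivalent to `-Q'`, then the totally isotropic subspaces
of `Q'` are as small as if `Q'` contained `-Q`. -/
lemma HasLagrangian.two_mul_finrank_add_le [FiniteDimensional K V] [FiniteDimensional K V']
    {Q : QuadraticForm K V} {Q' : QuadraticForm K V'} (h : HasLagrangian (Q.prod Q'))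
    (hQ : Q.Anisotropic) (hQ' : IsNonsingular Q') {T : Submodule K V'}
    (hT : IsTotallyIsotropic Q' T) : 2 * finrank K T + finrank K V ≤ finrank K V' := by
  obtain ⟨L, hL, hd⟩ := h
  let U : Submodule K (V × V') := T.map (LinearMap.inr K V V')
  let P : Submodule K (V × V') := L ⊓ QuadraticForm.perp (Q.prod Q') U
  have hzero : ∀ p ∈ L, Q' p.2 = 0 → p.1 = 0 := by
    intro p hp h0
    refine hQ _ ?_
    simpa [h0] using hL p hp
  have h1 : finrank K L + finrank K (L ⊓ U : Submodule K (V × V')) ≤ finrank K P + finrank K U :=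
    hL.finrank_add_finrank_inf_le U
  have h2 : finrank K U = finrank K T :=
    (Submodule.equivMapOfInjective _ LinearMap.inr_injective T).finrank_eq.symm
  have h3 : finrank K (P.map (LinearMap.snd K V V')) = finrank K P := by
    rw [← LinearMap.range_domRestrict]
    refine LinearMap.finrank_range_of_inj ?_
    rw [← LinearMap.ker_eq_bot, LinearMap.ker_eq_bot']
    rintro ⟨p, hp⟩ h0
    have h0' : p.2 = 0 := h0
    have := hzero p hp.1 (by rw [h0', QuadraticMap.map_zero])
    exact Subtype.ext (Prod.ext this h0')
  have h4 : P.map (LinearMap.snd K V V') ⊔ T ≤ QuadraticForm.perp Q' T := by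
    refine sup_le ?_ fun x hx => QuadraticForm.mem_perp.2 fun u hu => hT.polar_eq_zero hu hx
    rintro _ ⟨p, hp, rfl⟩
    refine QuadraticForm.mem_perp.2 fun u hu => ?_
    have := QuadraticForm.mem_perp.1 hp.2 (LinearMap.inr K V V' u) ⟨u, hu, rfl⟩
    simpa using this
  have h5 : P.map (LinearMap.snd K V V') ⊓ T ≤
      (L ⊓ U : Submodule K (V × V')).map (LinearMap.snd K V V') := by
    rintro _ ⟨⟨p, hp, rfl⟩, hpT⟩
    have h0 := hzero p hp.1 (hT _ hpT)
    exact ⟨p, ⟨hp.1, ⟨p.2, hpT, Prod.ext h0.symm rfl⟩⟩, rfl⟩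
  have h6 := Submodule.finrank_mono h4
  have h7 := (Submodule.finrank_mono h5).trans (Submodule.finrank_map_le _ _)
  have h8 := Submodule.finrank_sup_add_finrank_inf_eq (P.map (LinearMap.snd K V V')) T
  have h9 := hQ'.finrank_perp T
  rw [finrank_prod] at hd
  omega

end AnisotropicWitt

/-! ### Diagonal forms -/

section Diagonal

variable {K : Type*} [Field K]

lemma QuadraticMap.Anisotropic.exists_diagonalization {V : Type*} [AddCommGroup V] [Module K V]
    [FiniteDimensional K V] {Q : QuadraticForm K V} (h : Q.Anisotropic) (h2 : (2 : K) ≠ 0) {d : ℕ}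
    (hd : finrank K V = d) :
    ∃ w : Fin d → K, (∀ i, w i ≠ 0) ∧ Nonempty (Q.IsometryEquiv
      (weightedSumSquares K w)) := by
  subst hd
  have := invertibleOfNonzero h2
  obtain ⟨w, ⟨e⟩⟩ := QuadraticForm.equivalent_weightedSumSquares Q
  refine ⟨w, fun i hi => ?_, ⟨e⟩⟩
  classical
  have h0 : Q (e.symm (Pi.single i 1)) = 0 := by
    rw [e.symm.map_app, weightedSumSquares_apply, Finset.sum_eq_single i]
    · simp [hi]
    · intro j _ hj
      simp [hj]
    · simp
  have h1 : e.symm (Pi.single i (1 : K)) = 0 := h _ h0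
  have h3 : (Pi.single i (1 : K) : Fin (finrank K V) → K) = 0 := by
    have := congrArg e h1
    rwa [QuadraticMap.IsometryEquiv.apply_symm_apply, map_zero] at this
  simpa using congrFun h3 i

lemma isNonsingular_weightedSumSquares {n : Type*} [Fintype n] {w : n → K} (h2 : (2 : K) ≠ 0)
    (hw : ∀ i, w i ≠ 0) : IsNonsingular (weightedSumSquares K w) := by
  classical
  intro x hx
  funext i
  have h : ∑ j, (2 * (w j * x j)) * (Pi.single i 1 : n → K) j = 0 := by
    rw [← hx (Pi.single i 1)]
    simp only [polar, weightedSumSquares_apply, Pi.add_apply, smul_eq_mul]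
    rw [← Finset.sum_sub_distrib, ← Finset.sum_sub_distrib]
    exact Finset.sum_congr rfl fun j _ => by ring
  rw [Finset.sum_eq_single i] at h
  · simpa [h2, hw i] using h
  · intro j _ hj
    simp [hj]
  · simp

/-- Multiplying the coefficients of a diagonal form by nonzero sums of squares preserves weak
metabolicity: a suitable multiple of the form does not change at all. -/
lemma IsWeaklyMetabolic.weightedSumSquares_mul {n : Type*} [Fintype n] {w s : n → K}
    (h : IsWeaklyMetabolic (weightedSumSquares K w)) (hs : ∀ i, IsSumSq (s i))
    (hs0 : ∀ i, s i ≠ 0) : IsWeaklyMetabolic (weightedSumSquares K (w * s)) := by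
  obtain ⟨m, hm, h⟩ := h
  obtain ⟨ι, _, _, _, hT⟩ := exists_similitudes hs
  choose T hT using hT
  have : Nonempty (Fin m) := ⟨⟨0, hm⟩⟩
  refine IsWeaklyMetabolic.of_fintype (ι × Fin m) ?_
  let f : (ι → Fin m → n → K) →ₗ[K] (ι × Fin m → n → K) :=
    { toFun := fun x p i => (s i)⁻¹ * (T i).mulVec (fun k => x k p.2 i) p.1
      map_add' := fun x y => by
        funext p i
        have := congrFun (Matrix.mulVec_add (T i) (fun k => x k p.2 i) fun k => y k p.2 i) p.1
        rw [Pi.add_apply] at this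
        simp only [Pi.add_apply]
        linear_combination (s i)⁻¹ * this
      map_smul' := fun r x => by
        funext p i
        have := congrFun (Matrix.mulVec_smul (T i) r fun k => x k p.2 i) p.1
        rw [Pi.smul_apply, smul_eq_mul] at this
        simp only [Pi.smul_apply, smul_eq_mul, RingHom.id_apply]
        linear_combination (s i)⁻¹ * this }
  refine (h.pi ι).of_injective f ?_ ?_ ?_
  · rw [← LinearMap.ker_eq_bot, LinearMap.ker_eq_bot']
    intro x hx
    funext k l i
    have h1 : (T i).mulVec (fun k => x k l i) = 0 := by
      funext k
      have := congrFun (congrFun hx (k, l)) i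
      exact (mul_eq_zero.1 this).resolve_left (inv_ne_zero (hs0 i))
    have h3 := congrArg (Matrix.mulVec (T i).transpose) h1
    rw [Matrix.mulVec_mulVec, hT, Matrix.smul_mulVec, Matrix.one_mulVec, Matrix.mulVec_zero] at h3
    have := congrFun h3 k
    simpa [hs0 i] using this
  · intro x
    simp only [orthogonalMultiple, QuadraticMap.pi_apply, weightedSumSquares_apply,
      Fintype.sum_prod_type, smul_eq_mul, Pi.mul_apply]
    rw [Finset.sum_comm, Finset.sum_comm (s := (Finset.univ : Finset ι))]
    refine Finset.sum_congr rfl fun l _ => ?_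
    rw [Finset.sum_comm, Finset.sum_comm (s := (Finset.univ : Finset ι))]
    refine Finset.sum_congr rfl fun i _ => ?_
    have h1 := Matrix.sum_mulVec_sq_of_transpose_mul_self (hT i) (fun k => x k l i)
    have h3 : ∀ k, w i * s i * (f x (k, l) i * f x (k, l) i) =
        w i * (s i)⁻¹ * ((T i).mulVec (fun k => x k l i) k) ^ 2 := by
      intro k
      have := hs0 i
      simp only [f, LinearMap.coe_mk, AddHom.coe_mk]
      field_simp
    simp only [h3]
    rw [← Finset.mul_sum, h1, ← Finset.mul_sum]
    have := hs0 i
    field_simp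
  · simp only [finrank_pi_fintype, finrank_self, Finset.sum_const, smul_eq_mul, Finset.card_univ,
      Fintype.card_prod, mul_one, mul_assoc, le_refl]

end Diagonal

/-! ### Torsion forms over real fields -/

section Semireal

variable {F : Type*} [Field F]

lemma IsSemireal.two_ne_zero [IsSemireal F] : (2 : F) ≠ 0 := by
  have := IsSemireal.one_add_ne_zero (IsSumSq.one (R := F))
  rwa [one_add_one_eq_two] at this

lemma IsSemireal.eq_zero_of_sum_sq_eq_zero [IsSemireal F] {ι : Type*} [Fintype ι] {y : ι → F}
    (h : ∑ k, y k ^ 2 = 0) (k : ι) : y k = 0 := by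
  classical
  by_contra hk
  refine IsSemireal.one_add_ne_zero
    (IsSumSq.sum_sq (Finset.univ.erase k) fun l => y l / y k) ?_
  rw [← Finset.add_sum_erase _ _ (Finset.mem_univ k)] at h
  simp only [div_pow]
  rw [← Finset.sum_div]
  field_simp
  rw [h, mul_zero]

/-- Pfister's description of the Witt classes of torsion forms over a real field: up to Witt
equivalence they are orthogonal sums of forms `a (X² - s Y²)` with `s` a sum of squares. An
isotropic vector of `m × Q`, for `Q` diagonal with coefficients `w i`, yields sums of squares `s i`
such that the form with coefficients `w i * s i` is isotropic; the difference of both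
forms is of the asserted type, and the anisotropic part of the new one has smaller dimension. -/
theorem exists_hasLagrangian_prod_blockForm [IsSemireal F] (d : ℕ) :
    ∀ Q : QuadraticForm F (Fin d → F), Q.Anisotropic → IsWeaklyMetabolic Q →
      ∃ (ι : Type) (_ : Fintype ι) (a s : ι → F), (∀ i, a i ≠ 0) ∧ (∀ i, s i ≠ 0) ∧
        (∀ i, IsSumSq (s i)) ∧ HasLagrangian (Q.prod (blockForm a 0 (-(a * s)))) := by
  have h2 : (2 : F) ≠ 0 := IsSemireal.two_ne_zero
  induction d using Nat.strong_induction_on with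
  | _ d ih =>
  intro Q hQ hWM
  rcases Nat.eq_zero_or_pos d with rfl | hd
  · refine ⟨Empty, inferInstance, Empty.elim, Empty.elim, by simp, by simp, by simp, ⊥, ?_, ?_⟩
    · intro x hx
      rw [(Submodule.mem_bot F).1 hx, QuadraticMap.map_zero]
    · rw [finrank_prod]
      simp
  obtain ⟨w, hw, ⟨e⟩⟩ := hQ.exists_diagonalization h2 (finrank_fin_fun F)
  have hWMw : IsWeaklyMetabolic (weightedSumSquares F w) :=
    hWM.of_linearEquiv e.toLinearEquiv fun x => e.map_app x
  -- A nonzero vector in a Lagrangian of a multiple of the diagonal form.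
  obtain ⟨m, x, hx0, hx⟩ : ∃ (m : ℕ) (x : Fin m → Fin d → F), x ≠ 0 ∧
      ∑ i, w i * ∑ k, x k i ^ 2 = 0 := by
    obtain ⟨m, hm, L, hL, hdL⟩ := hWMw
    have hLbot : L ≠ ⊥ := by
      rintro rfl
      rw [finrank_bot, finrank_pi_fintype] at hdL
      simp only [finrank_fin_fun, Finset.sum_const, Finset.card_univ, Fintype.card_fin,
        smul_eq_mul] at hdL
      nlinarith [Nat.mul_pos hm hd]
    obtain ⟨x, hxL, hx0⟩ := L.ne_bot_iff.1 hLbot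
    refine ⟨m, x, hx0, ?_⟩
    rw [← hL x hxL]
    simp only [orthogonalMultiple, QuadraticMap.pi_apply, weightedSumSquares_apply, smul_eq_mul,
      Finset.mul_sum]
    rw [Finset.sum_comm]
    exact Finset.sum_congr rfl fun k _ => Finset.sum_congr rfl fun i _ => by ring
  classical
  let s : Fin d → F := fun i => if ∑ k, x k i ^ 2 = 0 then 1 else ∑ k, x k i ^ 2
  have hs0 : ∀ i, s i ≠ 0 := by
    intro i
    by_cases hi : ∑ k, x k i ^ 2 = 0 <;> simp [s, hi]
  have hs : ∀ i, IsSumSq (s i) := by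
    intro i
    by_cases hi : ∑ k, x k i ^ 2 = 0
    · simp [s, hi]
    · simp only [s, hi, if_false]
      exact IsSumSq.sum_sq _ _
  let v : Fin d → F := fun i => if ∑ k, x k i ^ 2 = 0 then 0 else 1
  have hv0 : v ≠ 0 := by
    intro hv
    refine hx0 (funext fun k => funext fun i => ?_)
    refine IsSemireal.eq_zero_of_sum_sq_eq_zero (y := fun k => x k i) ?_ k
    by_contra hi
    have := congrFun hv i
    simp [v, hi] at this
  have hv : weightedSumSquares F (w * s) v = 0 := by
    rw [weightedSumSquares_apply, ← hx]
    refine Finset.sum_congr rfl fun i _ => ?_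
    by_cases hi : ∑ k, x k i ^ 2 = 0 <;> simp [s, v, hi]
  have hWM' := hWMw.weightedSumSquares_mul hs hs0
  have hns : IsNonsingular (weightedSumSquares F (w * s)) :=
    isNonsingular_weightedSumSquares h2 fun i => mul_ne_zero (hw i) (hs0 i)
  obtain ⟨U, W, hU, hW, hortho, hperp, hdim, hdisj, hmax⟩ := hns.exists_anisotropic_part
  have hUpos : 0 < finrank F U := by
    have := hmax (F ∙ v) (by
      intro y hy
      obtain ⟨c, rfl⟩ := Submodule.mem_span_singleton.1 hy
      rw [QuadraticMap.map_smul, hv, smul_zero])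
    rw [finrank_span_singleton hv0] at this
    omega
  rw [finrank_fin_fun] at hdim
  let e₂ : (Fin (finrank F W) → F) ≃ₗ[F] W := (finBasis F W).equivFun.symm
  let Q₂ := ((weightedSumSquares F (w * s)).comp W.subtype).comp
    (e₂ : (Fin (finrank F W) → F) →ₗ[F] W)
  have hQ₂ : Q₂.Anisotropic := fun y hy => e₂.map_eq_zero_iff.1 (hW _ hy)
  have hWM₂ : IsWeaklyMetabolic Q₂ :=
    (hWM'.comp_subtype hU hortho hperp (by rwa [finrank_fin_fun])).of_linearEquiv e₂.symm
      fun y => by simp [Q₂]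
  obtain ⟨ι, _, a, t, ha, ht0, ht, L, hL, hdL⟩ :=
    ih (finrank F W) (by omega) Q₂ hQ₂ hWM₂
  refine ⟨Fin d ⊕ ι, inferInstance, Sum.elim (-w) a, Sum.elim s t, ?_, ?_, ?_, ?_⟩
  · rintro (i | i)
    · simpa using hw i
    · exact ha i
  · rintro (i | i)
    · exact hs0 i
    · exact ht0 i
  · rintro (i | i)
    · exact hs i
    · exact ht i
  let g : (Fin (finrank F W) → F) →ₗ[F] (Fin d → F) :=
    W.subtype ∘ₗ (e₂ : (Fin (finrank F W) → F) →ₗ[F] W)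
  -- The new Lagrangian is the sum of the graph of the isometry `e` of `Q` with its diagonal form and
  -- of the preimage in `U^⊥` of the Lagrangian for the anisotropic part.
  let f : ((Fin d → F) × U × L) →ₗ[F]
      (Fin d → F) × (((Fin d ⊕ ι) ⊕ (Fin d ⊕ ι)) → F) :=
    { toFun := fun p => (e.toLinearEquiv.symm p.1,
        Sum.elim (Sum.elim p.1 fun i => p.2.2.1.2 (Sum.inl i))
          (Sum.elim ((p.2.1 : Fin d → F) + g p.2.2.1.1)
            fun i => p.2.2.1.2 (Sum.inr i)))
      map_add' := fun p q => by
        refine Prod.ext (map_add _ _ _) ?_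
        funext i
        rcases i with (i | i) | (i | i)
        · rfl
        · rfl
        · simp only [Sum.elim_inr, Sum.elim_inl, Prod.snd_add, Prod.fst_add, Submodule.coe_add,
            map_add, Pi.add_apply]
          ring
        · rfl
      map_smul' := fun r p => by
        refine Prod.ext (map_smul _ _ _) ?_
        funext i
        rcases i with (i | i) | (i | i)
        · rfl
        · rfl
        · simp only [Sum.elim_inr, Sum.elim_inl, Prod.smul_snd, Prod.smul_fst, Submodule.coe_smul,
            map_smul, Pi.smul_apply, Pi.add_apply, RingHom.id_apply, smul_add]
        · rfl }
  have hf : Function.Injective f := by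
    rw [← LinearMap.ker_eq_bot, LinearMap.ker_eq_bot']
    rintro ⟨y, ⟨u, hu⟩, ⟨⟨l₁, l₂⟩, hl⟩⟩ h0
    have h0' := congrArg Prod.snd h0
    have hy : y = 0 := funext fun i => congrFun h0' (Sum.inl (Sum.inl i))
    have hl₂ : l₂ = 0 := by
      funext i
      rcases i with i | i
      · exact congrFun h0' (Sum.inl (Sum.inr i))
      · exact congrFun h0' (Sum.inr (Sum.inr i))
    have hug : u + g l₁ = 0 := funext fun i => congrFun h0' (Sum.inr (Sum.inl i))
    have hgU : g l₁ ∈ U := by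
      rw [eq_neg_of_add_eq_zero_right hug]
      exact U.neg_mem hu
    have hg0 : g l₁ = 0 := Submodule.disjoint_def.1 hdisj _ hgU (e₂ l₁).2
    have hl₁ : l₁ = 0 := e₂.map_eq_zero_iff.1 (Subtype.ext hg0)
    have hu0 : u = 0 := by rwa [hg0, add_zero] at hug
    subst hy hl₂ hl₁ hu0
    rfl
  refine ⟨LinearMap.range f, ?_, ?_⟩
  · rintro _ ⟨⟨y, ⟨u, hu⟩, ⟨⟨l₁, l₂⟩, hl⟩⟩, rfl⟩
    have h1 : Q (e.toLinearEquiv.symm y) = weightedSumSquares F w y := e.symm.map_app y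
    have h3 : weightedSumSquares F (w * s) (u + g l₁) = Q₂ l₁ := by
      have hpol : polar (weightedSumSquares F (w * s)) u (g l₁) = 0 := hortho u hu _ (e₂ l₁).2
      rw [QuadraticMap.map_add (weightedSumSquares F (w * s)), hU u hu, hpol, zero_add, add_zero]
      rfl
    have h4 := hL _ hl
    rw [QuadraticMap.prod_apply, ← h3, weightedSumSquares_apply, blockForm_apply] at h4
    rw [QuadraticMap.prod_apply]
    change Q (e.toLinearEquiv.symm y) + _ = 0
    rw [h1, weightedSumSquares_apply, blockForm_apply, Fintype.sum_sum_type, ← h4, ← add_assoc,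
      ← Finset.sum_add_distrib]
    refine congrArg₂ (· + ·) (Finset.sum_congr rfl fun i _ => ?_) rfl
    simp [f]
    ring
  · rw [LinearMap.finrank_range_of_inj hf]
    simp only [finrank_prod, finrank_pi_fintype, finrank_self, Finset.sum_const, smul_eq_mul,
      Finset.card_univ, Fintype.card_sum, Fintype.card_fin, mul_one] at hdL ⊢
    omega

end Semireal

/-! ### Reduction of forms modulo the maximal ideal -/

section Residue

variable {K : Type*} [Field K] {Γ₀ : Type*} [LinearOrderedCommGroupWithZero Γ₀]
  {v : Valuation K Γ₀} {ι : Type*}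

/-- The form `Q` over `K` has integral values on integral vectors, and its reduction modulo the
maximal ideal of the valuation ring is the form `q`. -/
def ReducesTo (v : Valuation K Γ₀) (Q : QuadraticForm K (ι → K))
    (q : QuadraticForm v.residueFieldK (ι → v.residueFieldK)) : Prop :=
  ∀ x : ι → v.valuationSubring, ∃ y : v.valuationSubring, (y : K) = Q (fun i => (x i : K)) ∧
    IsLocalRing.residue v.valuationSubring y =
      q fun i => IsLocalRing.residue v.valuationSubring (x i)

lemma residue_eq_zero_iff_lt_one (y : v.valuationSubring) :
    IsLocalRing.residue v.valuationSubring y = 0 ↔ v (y : K) < 1 := by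
  rw [IsLocalRing.residue_eq_zero_iff]
  exact v.mem_maximalIdeal_iff

lemma ReducesTo.valuation_le [Finite ι] {Q : QuadraticForm K (ι → K)}
    {q : QuadraticForm v.residueFieldK (ι → v.residueFieldK)} (h : ReducesTo v Q q)
    {x : ι → K} {c : K} (hc : ∀ i, v (x i) ≤ v c) : v (Q x) ≤ v c ^ 2 := by
  rcases eq_or_ne c 0 with rfl | hc0
  · have : x = 0 := by
      funext i
      have := hc i
      rwa [map_zero, le_zero_iff, map_eq_zero] at this
    simp [this]
  have hm : ∀ i, c⁻¹ * x i ∈ v.valuationSubring := by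
    intro i
    rw [Valuation.mem_valuationSubring_iff, map_mul, map_inv₀]
    exact inv_mul_le_one_of_le₀ (hc i) zero_le
  obtain ⟨y, hy, -⟩ := h fun i => ⟨c⁻¹ * x i, hm i⟩
  have hx : x = c • fun i => c⁻¹ * x i := by
    funext i
    simp [hc0]
  rw [hx, QuadraticMap.map_smul]
  rw [← hy, smul_eq_mul, map_mul, map_mul, ← _root_.sq]
  exact mul_le_of_le_one_right' y.2

/-- The leading vectors of a subspace `U` in the component `j`: the reductions of the integral
`j`-th components of those vectors in `U` whose other components are dominated, with respect to the
norm `x ↦ max v (t i * x i k ^ 2)`, by the scaling factor `t j`. -/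
def leadingSpace (v : Valuation K Γ₀) {J : Type*} (t : J → Kˣ) (U : Submodule K (J → ι → K))
    (j : J) : Submodule v.residueFieldK (ι → v.residueFieldK) where
  carrier := {z | ∃ u ∈ U, ∃ y : ι → v.valuationSubring, (∀ k, (y k : K) = u j k) ∧
    (∀ i, i ≠ j → ∀ k, v (t i) * v (u i k) ^ 2 < v (t j)) ∧
    z = fun k => IsLocalRing.residue v.valuationSubring (y k)}
  add_mem' := by
    rintro _ _ ⟨u, hu, y, hy, hd, rfl⟩ ⟨u', hu', y', hy', hd', rfl⟩
    refine ⟨u + u', U.add_mem hu hu', y + y', fun k => ?_, fun i hi k => ?_, ?_⟩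
    · simp [hy, hy']
    · rcases le_max_iff.1 (v.map_add (u i k) (u' i k)) with h | h
      · exact (mul_le_mul_right (pow_le_pow_left₀ zero_le h 2) _).trans_lt (hd i hi k)
      · exact (mul_le_mul_right (pow_le_pow_left₀ zero_le h 2) _).trans_lt (hd' i hi k)
    · funext k
      simp
  zero_mem' := by
    refine ⟨0, U.zero_mem, 0, fun k => by simp, fun i hi k => ?_, by funext k; simp⟩
    simp [zero_lt_iff]
  smul_mem' := by
    rintro c _ ⟨u, hu, y, hy, hd, rfl⟩
    obtain ⟨c, rfl⟩ := IsLocalRing.residue_surjective c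
    refine ⟨(c : K) • u, U.smul_mem _ hu, c • y, fun k => ?_, fun i hi k => ?_, ?_⟩
    · simp [hy]
    · refine lt_of_le_of_lt (mul_le_mul_right (pow_le_pow_left₀ zero_le ?_ 2) _) (hd i hi k)
      simp only [Pi.smul_apply, smul_eq_mul, map_mul]
      exact mul_le_of_le_one_left' c.2
    · funext k
      simp

lemma leadingSpace_mono {J : Type*} (t : J → Kˣ) {U U' : Submodule K (J → ι → K)} (h : U ≤ U')
    (j : J) : leadingSpace v t U j ≤ leadingSpace v t U' j := by
  rintro _ ⟨u, hu, y, hy⟩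
  exact ⟨u, h hu, y, hy⟩

lemma isTotallyIsotropic_leadingSpace [Finite ι] {J : Type*} [Fintype J] {t : J → Kˣ}
    {Q : QuadraticForm K (ι → K)} {q : QuadraticForm v.residueFieldK (ι → v.residueFieldK)}
    (h : ReducesTo v Q q) {U : Submodule K (J → ι → K)}
    (hU : IsTotallyIsotropic (QuadraticMap.pi fun j => (t j : K) • Q) U) (j : J) :
    IsTotallyIsotropic q (leadingSpace v t U j) := by
  classical
  rintro _ ⟨u, hu, y, hy, hd, rfl⟩
  obtain ⟨z, hz, hz'⟩ := h y
  have hyu : (fun k => (y k : K)) = u j := funext hy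
  rw [← hz', residue_eq_zero_iff_lt_one, hz, hyu]
  have htj : 0 < v (t j : K) := by simp [zero_lt_iff]
  have hlt : ∀ i ∈ Finset.univ.erase j, v ((t i : K) * Q (u i)) < v (t j : K) := by
    intro i hi
    rcases isEmpty_or_nonempty ι with hι | hι
    · have : u i = 0 := Subsingleton.elim _ _
      simpa [this] using htj
    · obtain ⟨k, hk⟩ := Finite.exists_max fun k => v (u i k)
      rw [map_mul]
      exact (mul_le_mul_right (h.valuation_le hk) _).trans_lt (hd i (Finset.ne_of_mem_erase hi) k)
  have hsum := hU u hu
  simp only [QuadraticMap.pi_apply, _root_.smul_apply, smul_eq_mul] at hsum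
  rw [← Finset.add_sum_erase _ _ (Finset.mem_univ j)] at hsum
  have h1 := v.map_sum_lt htj.ne' hlt
  rw [← v.map_neg, ← eq_neg_of_add_eq_zero_left hsum, map_mul] at h1
  by_contra hge
  exact absurd h1 (not_lt.2 (le_mul_of_one_le_right' (not_lt.1 hge)))

/-- The leading spaces of `U` together have at least the dimension of `U`. This is Gaussian
elimination, where the pivot of a vector is an entry at which its norm is attained. -/
lemma finrank_le_sum_finrank_leadingSpace [Fintype ι] {J : Type*} [Fintype J] {t : J → Kˣ}
    (ht : ∀ i j, i ≠ j → ∀ c : K, c ≠ 0 → v (t i) * v c ^ 2 ≠ v (t j)) (d : ℕ) :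
    ∀ U : Submodule K (J → ι → K), d ≤ finrank K U →
      d ≤ ∑ j, finrank v.residueFieldK (leadingSpace v t U j) := by
  classical
  induction d with
  | zero => exact fun _ _ => Nat.zero_le _
  | succ d ih =>
    intro U hU
    have hUbot : U ≠ ⊥ := by
      rintro rfl
      simp at hU
    obtain ⟨u, hu, hu0⟩ := U.ne_bot_iff.1 hUbot
    obtain ⟨i₀, k₀, hik⟩ : ∃ i k, u i k ≠ 0 := by
      by_contra! h
      exact hu0 (funext fun i => funext fun k => h i k)
    have : Nonempty (J × ι) := ⟨(i₀, k₀)⟩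
    obtain ⟨⟨j, k⟩, hmax⟩ := Finite.exists_max fun p : J × ι => v (t p.1) * v (u p.1 p.2) ^ 2
    have hjk : u j k ≠ 0 := by
      intro h0
      have := hmax (i₀, k₀)
      simp [h0, hik] at this
    let c := u j k
    -- The vector `c⁻¹ • u` has the entry `1` at the pivot `(j, k)`.
    have hle : ∀ i l, v (t i) * v (c⁻¹ * u i l) ^ 2 ≤ v (t j) := by
      intro i l
      have h1 := hmax (i, l)
      have h3 : v c ^ 2 ≠ 0 := by simpa [c] using hjk
      rw [map_mul, map_inv₀, mul_pow, inv_pow]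
      calc v (t i) * ((v c ^ 2)⁻¹ * v (u i l) ^ 2)
          = (v c ^ 2)⁻¹ * (v (t i) * v (u i l) ^ 2) := mul_left_comm _ _ _
        _ ≤ (v c ^ 2)⁻¹ * (v (t j) * v c ^ 2) := mul_le_mul_right h1 _
        _ = v (t j) := by rw [mul_comm, mul_assoc, mul_inv_cancel₀ h3, mul_one]
    have hint : ∀ l, c⁻¹ * u j l ∈ v.valuationSubring := by
      intro l
      rw [Valuation.mem_valuationSubring_iff]
      by_contra hlt
      have h1 := hle j l
      have h3 : 0 < v (t j : K) := by simp [zero_lt_iff]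
      have h4 : 1 < v (c⁻¹ * u j l) ^ 2 := one_lt_pow₀ (not_le.1 hlt) two_ne_zero
      exact absurd h1 (not_le.2 (lt_mul_of_one_lt_right h3 h4))
    let z : ι → v.residueFieldK :=
      fun l => IsLocalRing.residue v.valuationSubring ⟨c⁻¹ * u j l, hint l⟩
    have hzk : z k = 1 := by
      have : (⟨c⁻¹ * u j k, hint k⟩ : v.valuationSubring) = 1 := Subtype.ext (inv_mul_cancel₀ hjk)
      simp only [z, this, map_one]
    have hz : z ∈ leadingSpace v t U j := by
      refine ⟨c⁻¹ • u, U.smul_mem _ hu, fun l => ⟨c⁻¹ * u j l, hint l⟩, fun l => rfl,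
        fun i hi l => ?_, rfl⟩
      refine lt_of_le_of_ne (hle i l) ?_
      change v (t i) * v (c⁻¹ * u i l) ^ 2 ≠ v (t j)
      by_cases h0 : c⁻¹ * u i l = 0
      · rw [h0, map_zero, zero_pow two_ne_zero, mul_zero]
        exact (v.ne_zero_iff.2 (t j).ne_zero).symm
      · exact ht i j hi _ h0
    let φ : U →ₗ[K] K := (LinearMap.proj k ∘ₗ LinearMap.proj j) ∘ₗ U.subtype
    let U' : Submodule K (J → ι → K) := (LinearMap.ker φ).map U.subtype
    have hU' : d ≤ finrank K U' := by
      have h1 := φ.finrank_range_add_finrank_ker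
      have h3 : finrank K (LinearMap.range φ) ≤ 1 := by
        simpa using Submodule.finrank_le (LinearMap.range φ)
      have h4 : finrank K U' = finrank K (LinearMap.ker φ) := Submodule.finrank_map_subtype_eq _ _
      omega
    have hU'U : U' ≤ U := Submodule.map_subtype_le _ _
    have hz' : z ∉ leadingSpace v t U' j := by
      rintro ⟨_, ⟨w, hw, rfl⟩, y, hy, -, hzy⟩
      have h0 : (y k : K) = 0 := (hy k).trans hw
      have h1 : y k = 0 := Subtype.ext h0
      have h3 := congrFun hzy k
      rw [hzk, h1, map_zero] at h3
      exact one_ne_zero h3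
    have hlt : finrank v.residueFieldK (leadingSpace v t U' j) <
        finrank v.residueFieldK (leadingSpace v t U j) :=
      Submodule.finrank_lt_finrank_of_lt (lt_of_le_of_ne (leadingSpace_mono t hU'U j)
        fun h => hz' (h ▸ hz))
    refine lt_of_le_of_lt (ih U' hU') (Finset.sum_lt_sum (fun i _ => ?_) ⟨j, Finset.mem_univ _, hlt⟩)
    exact Submodule.finrank_mono (leadingSpace_mono t hU'U i)

/-- Springer's argument: if the scaling factors `t j` lie in different classes modulo `2vK` and the
totally isotropic subspaces of the reduction of `Q` have dimension at most `r`, then each summand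
`t j • Q` contributes at most `r` to a totally isotropic subspace of the orthogonal sum. -/
theorem ReducesTo.finrank_le_of_isTotallyIsotropic [Fintype ι] {J : Type*} [Fintype J] {t : J → Kˣ}
    {Q : QuadraticForm K (ι → K)} {q : QuadraticForm v.residueFieldK (ι → v.residueFieldK)}
    (h : ReducesTo v Q q)
    (ht : ∀ i j, i ≠ j → ∀ c : K, c ≠ 0 → v (t i) * v c ^ 2 ≠ v (t j)) {r : ℕ}
    (hr : ∀ T, IsTotallyIsotropic q T → finrank v.residueFieldK T ≤ r)
    {U : Submodule K (J → ι → K)}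
    (hU : IsTotallyIsotropic (QuadraticMap.pi fun j => (t j : K) • Q) U) :
    finrank K U ≤ Fintype.card J * r := by
  refine (finrank_le_sum_finrank_leadingSpace ht _ U le_rfl).trans ?_
  refine (Finset.sum_le_sum fun j _ => hr _ (isTotallyIsotropic_leadingSpace h hU j)).trans ?_
  simp

lemma ReducesTo.anisotropic_pi_smul [Fintype ι] {J : Type*} [Fintype J] {t : J → Kˣ}
    {Q : QuadraticForm K (ι → K)} {q : QuadraticForm v.residueFieldK (ι → v.residueFieldK)}
    (h : ReducesTo v Q q)
    (ht : ∀ i j, i ≠ j → ∀ c : K, c ≠ 0 → v (t i) * v c ^ 2 ≠ v (t j)) (hq : q.Anisotropic) :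
    (QuadraticMap.pi fun j => (t j : K) • Q).Anisotropic := by
  intro x hx
  by_contra hx0
  have := h.finrank_le_of_isTotallyIsotropic ht (r := 0) (U := K ∙ x) (fun T hT => ?_) ?_
  · rw [finrank_span_singleton hx0] at this
    simp at this
  · have : T = ⊥ := (Submodule.eq_bot_iff T).2 fun y hy => hq y (hT y hy)
    simp [this]
  · intro y hy
    obtain ⟨c, rfl⟩ := Submodule.mem_span_singleton.1 hy
    rw [QuadraticMap.map_smul, hx, smul_zero]

end Residue

/-! ### Splitting off binary forms in arbitrary characteristic -/

section BinaryDecomposition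

variable {F V : Type*} [Field F] [AddCommGroup V] [Module F V]

lemma Submodule.finrank_le_finrank_inf_ker_add_one [FiniteDimensional F V] (X : Submodule F V)
    (φ : V →ₗ[F] F) : finrank F X ≤ finrank F (X ⊓ LinearMap.ker φ : Submodule F V) + 1 := by
  have h1 := (φ.domRestrict X).finrank_range_add_finrank_ker
  have h2 : finrank F (LinearMap.range (φ.domRestrict X)) ≤ 1 := by
    simpa using Submodule.finrank_le (LinearMap.range (φ.domRestrict X))
  have h3 : (LinearMap.ker (φ.domRestrict X)).map X.subtype ≤ X ⊓ LinearMap.ker φ := by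
    rintro _ ⟨x, hx, rfl⟩
    exact ⟨x.2, hx⟩
  have h4 := Submodule.finrank_mono h3
  have h5 : finrank F ((LinearMap.ker (φ.domRestrict X)).map X.subtype) =
      finrank F (LinearMap.ker (φ.domRestrict X)) := Submodule.finrank_map_subtype_eq _ _
  omega

/-- A plane can be split off orthogonally from an anisotropic form of dimension at least two, in
any characteristic. If `2 ≠ 0` any plane does; if `2 = 0` a plane on which the polar form does
not vanish does, and if there is none, any plane again. -/
lemma QuadraticMap.Anisotropic.exists_plane [FiniteDimensional F V] {Q : QuadraticForm F V}
    (hQ : Q.Anisotropic) {X : Submodule F V} (hX : 2 ≤ finrank F X) :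
    ∃ e ∈ X, ∃ f ∈ X, ∃ W ≤ X, (∀ w ∈ W, polar Q e w = 0 ∧ polar Q f w = 0) ∧
      (∀ α β : F, ∀ w ∈ W, α • e + β • f + w = 0 → α = 0 ∧ β = 0 ∧ w = 0) ∧
      finrank F X ≤ finrank F W + 2 := by
  have hXbot : X ≠ ⊥ := by
    rintro rfl
    simp at hX
  obtain ⟨e, he, he0⟩ := X.ne_bot_iff.1 hXbot
  obtain ⟨f, hf, hfe⟩ : ∃ f ∈ X, f ∉ F ∙ e := by
    by_contra! h
    have := Submodule.finrank_mono (show X ≤ F ∙ e from h)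
    rw [finrank_span_singleton he0] at this
    omega
  have hindep : ∀ α β : F, α • e + β • f = 0 → α = 0 ∧ β = 0 := by
    intro α β h
    have hβ : β = 0 := by
      by_contra hβ
      refine hfe (Submodule.mem_span_singleton.2 ⟨-(β⁻¹ * α), ?_⟩)
      have h1 : β • f = -(α • e) := eq_neg_of_add_eq_zero_right h
      rw [neg_smul, mul_smul, ← smul_neg, ← h1, smul_smul, inv_mul_cancel₀ hβ, one_smul]
    rw [hβ, zero_smul, add_zero] at h
    exact ⟨(smul_eq_zero.1 h).resolve_right he0, hβ⟩
  have hperp : ∀ e f : V, finrank F X ≤ finrank F (X ⊓ LinearMap.ker (Q.polarBilin e) ⊓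
      LinearMap.ker (Q.polarBilin f) : Submodule F V) + 2 := by
    intro e f
    have h1 := X.finrank_le_finrank_inf_ker_add_one (Q.polarBilin e)
    have h2 := (X ⊓ LinearMap.ker (Q.polarBilin e)).finrank_le_finrank_inf_ker_add_one
      (Q.polarBilin f)
    omega
  by_cases h2 : (2 : F) = 0
  · have hself : ∀ x, polar Q x x = 0 := by
      intro x
      rw [polar_self, two_nsmul, ← two_mul, h2, zero_mul]
    by_cases hpol : ∃ e ∈ X, ∃ f ∈ X, polar Q e f ≠ 0
    · obtain ⟨e, he, f, hf, hef⟩ := hpol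
      refine ⟨e, he, f, hf, _, inf_le_left.trans inf_le_left, fun w hw => ⟨hw.1.2, hw.2⟩,
        fun α β w hw h => ?_, hperp e f⟩
      have h3 := congrArg (Q.polarBilin e) h
      have h4 := congrArg (Q.polarBilin f) h
      have hew : polar Q e w = 0 := hw.1.2
      have hfw : polar Q f w = 0 := hw.2
      simp only [map_add, map_smul, polarBilin_apply_apply, hself, hew, smul_eq_mul,
        mul_zero, zero_add, add_zero, map_zero, mul_eq_zero, hef, or_false] at h3
      simp only [map_add, map_smul, polarBilin_apply_apply, hself, hfw, smul_eq_mul,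
        mul_zero, add_zero, map_zero, polar_comm Q f e, mul_eq_zero, hef, or_false] at h4
      subst h3 h4
      simpa using h
    · push Not at hpol
      obtain ⟨C, hC⟩ := Submodule.exists_isCompl (F ∙ e ⊔ F ∙ f)
      have hle : F ∙ e ⊔ F ∙ f ≤ X := sup_le ((Submodule.span_singleton_le_iff_mem _ _).2 he)
        ((Submodule.span_singleton_le_iff_mem _ _).2 hf)
      have hmem : ∀ α β : F, α • e + β • f ∈ F ∙ e ⊔ F ∙ f := fun α β =>
        Submodule.add_mem_sup (Submodule.smul_mem _ _ (Submodule.mem_span_singleton_self e))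
          (Submodule.smul_mem _ _ (Submodule.mem_span_singleton_self f))
      refine ⟨e, he, f, hf, C ⊓ X, inf_le_right,
        fun w hw => ⟨hpol e he w hw.2, hpol f hf w hw.2⟩, fun α β w hw h => ?_, ?_⟩
      · have h3 : w = -(α • e + β • f) := eq_neg_of_add_eq_zero_right h
        have hw0 : w = 0 := Submodule.disjoint_def.1 hC.disjoint w
          (h3 ▸ Submodule.neg_mem _ (hmem α β)) hw.1
        rw [hw0, add_zero] at h
        exact ⟨(hindep α β h).1, (hindep α β h).2, hw0⟩
      · have h3 : (F ∙ e ⊔ F ∙ f) ⊔ C ⊓ X = X := by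
          rw [← sup_inf_assoc_of_le _ hle, hC.sup_eq_top, top_inf_eq]
        have h4 := Submodule.finrank_add_le_finrank_add_finrank (F ∙ e ⊔ F ∙ f) (C ⊓ X)
        have h5 := Submodule.finrank_add_le_finrank_add_finrank (F ∙ e) (F ∙ f)
        have h6 := finrank_span_singleton (K := F) he0
        have h7 : finrank F (F ∙ f) ≤ 1 := by simpa using finrank_span_le_card (R := F) {f}
        rw [h3] at h4
        omega
  · refine ⟨e, he, f, hf, _, inf_le_left.trans inf_le_left, fun w hw => ⟨hw.1.2, hw.2⟩,
      fun α β w hw h => ?_, hperp e f⟩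
    have hew : polar Q e w = 0 := hw.1.2
    have hfw : polar Q f w = 0 := hw.2
    have h3 : w = -(α • e + β • f) := eq_neg_of_add_eq_zero_right h
    have h4 : polar Q w w = 0 := by
      conv_lhs => rw [h3]
      rw [polar_neg_left, polar_add_left, polar_smul_left, polar_smul_left, ← h3, hew, hfw]
      simp
    rw [polar_self, two_nsmul, ← two_mul] at h4
    have hw0 : w = 0 := hQ w ((mul_eq_zero.1 h4).resolve_left h2)
    rw [hw0, add_zero] at h
    exact ⟨(hindep α β h).1, (hindep α β h).2, hw0⟩

/-- An anisotropic form of dimension at least `2m`, in any characteristic, contains an orthogonal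
sum of `m` binary forms. -/
lemma QuadraticMap.Anisotropic.exists_anisotropic_blockForm [FiniteDimensional F V]
    {Q : QuadraticForm F V} (hQ : Q.Anisotropic) {m : ℕ} (hm : 2 * m ≤ finrank F V) :
    ∃ a b c : Fin m → F, (blockForm a b c).Anisotropic := by
  suffices H : ∀ (m : ℕ) (X : Submodule F V), 2 * m ≤ finrank F X →
      ∃ (a b c : Fin m → F) (g : (Fin m ⊕ Fin m → F) →ₗ[F] V), Function.Injective g ∧
        (∀ x, g x ∈ X) ∧ ∀ x, Q (g x) = blockForm a b c x by
    obtain ⟨a, b, c, g, hg, -, hgQ⟩ := H m ⊤ (by rwa [finrank_top])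
    exact ⟨a, b, c, fun x hx => hg ((hQ _ ((hgQ x).trans hx)).trans (map_zero g).symm)⟩
  intro m
  induction m with
  | zero =>
    intro X _
    exact ⟨Fin.elim0, Fin.elim0, Fin.elim0, 0, fun x y _ => Subsingleton.elim _ _,
      fun x => X.zero_mem, fun x => by simp [blockForm_apply]⟩
  | succ m ih =>
    intro X hX
    obtain ⟨e, he, f, hf, W, hWX, hpol, hindep, hdim⟩ := hQ.exists_plane (X := X) (by omega)
    obtain ⟨a, b, c, g, hg, hgW, hgQ⟩ := ih W (by omega)
    let τ : (Fin (m + 1) ⊕ Fin (m + 1) → F) →ₗ[F] (Fin m ⊕ Fin m → F) :=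
      LinearMap.funLeft F F (Sum.map Fin.succ Fin.succ)
    let g' : (Fin (m + 1) ⊕ Fin (m + 1) → F) →ₗ[F] V :=
      (LinearMap.proj (Sum.inl 0)).smulRight e + (LinearMap.proj (Sum.inr 0)).smulRight f + g ∘ₗ τ
    have hg' : ∀ x, g' x = x (Sum.inl 0) • e + x (Sum.inr 0) • f + g (τ x) := fun x => rfl
    refine ⟨Fin.cons (Q e) a, Fin.cons (polar Q e f) b, Fin.cons (Q f) c, g', ?_, ?_, ?_⟩
    · rw [← LinearMap.ker_eq_bot, LinearMap.ker_eq_bot']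
      intro x hx
      obtain ⟨h1, h2, h3⟩ := hindep _ _ _ (hgW (τ x)) ((hg' x).symm.trans hx)
      have h4 : τ x = 0 := hg (h3.trans (map_zero g).symm)
      funext i
      rcases i with i | i
      · refine Fin.cases h1 (fun i => congrFun h4 (Sum.inl i)) i
      · refine Fin.cases h2 (fun i => congrFun h4 (Sum.inr i)) i
    · intro x
      rw [hg']
      exact X.add_mem (X.add_mem (X.smul_mem _ he) (X.smul_mem _ hf)) (hWX (hgW _))
    · intro x
      rw [hg', QuadraticMap.map_add Q (_ + _), QuadraticMap.map_add Q (_ • e), hgQ,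
        blockForm_apply, blockForm_apply, Fin.sum_univ_succ]
      simp only [polar_add_left, polar_smul_left, polar_smul_right, (hpol _ (hgW _)).1,
        (hpol _ (hgW _)).2, QuadraticMap.map_smul, Fin.cons_zero, Fin.cons_succ, smul_eq_mul,
        mul_zero, add_zero]
      refine congrArg₂ (· + ·) ?_ rfl
      ring

lemma QuadraticMap.Anisotropic.blockForm_ne_zero {n : Type*} [Fintype n] {a b c : n → F}
    (h : (blockForm a b c).Anisotropic) (i : n) : a i ≠ 0 := by
  classical
  intro hi
  have h0 : (Pi.single (Sum.inl i) 1 : n ⊕ n → F) = 0 := by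
    refine h _ ?_
    rw [blockForm_apply, Finset.sum_eq_single i]
    · simp [hi]
    · intro j _ hj
      simp [hj]
    · simp
  simpa using congrFun h0 (Sum.inl i)

end BinaryDecomposition

/-! ### Lifting forms from the residue field -/

section Lifting

variable {K : Type*} [Field K] {Γ₀ : Type*} [LinearOrderedCommGroupWithZero Γ₀]
  {v : Valuation K Γ₀}

lemma exists_reducesTo {n : ℕ}
    (q : QuadraticForm v.residueFieldK (Fin n → v.residueFieldK)) :
    ∃ Q : QuadraticForm K (Fin n → K), ReducesTo v Q q := by
  obtain ⟨B, rfl⟩ := LinearMap.BilinMap.toQuadraticMap_surjective q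
  choose M hM using fun i j => IsLocalRing.residue_surjective (R := v.valuationSubring)
    (B (Pi.single i 1) (Pi.single j 1))
  refine ⟨∑ i, ∑ j, (M i j : K) • linMulLin (LinearMap.proj i) (LinearMap.proj j), fun x =>
    ⟨∑ i, ∑ j, M i j * (x i * x j), ?_, ?_⟩⟩
  · simp [linMulLin_apply]
  · have hx : (fun i => IsLocalRing.residue v.valuationSubring (x i)) =
        ∑ i, IsLocalRing.residue v.valuationSubring (x i) • Pi.single i 1 :=
      pi_eq_sum_univ' _
    rw [LinearMap.BilinMap.toQuadraticMap_apply, hx]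
    simp only [map_sum, map_mul, hM, map_smul, LinearMap.sum_apply, LinearMap.smul_apply,
      smul_eq_mul]
    rw [Finset.sum_comm]
    refine Finset.sum_congr rfl fun i _ => ?_
    rw [Finset.mul_sum]
    exact Finset.sum_congr rfl fun j _ => by ring

lemma reducesTo_blockForm {n : Type*} [Fintype n] (a b c : n → v.valuationSubring) :
    ReducesTo v (blockForm (fun i => (a i : K)) (fun i => (b i : K)) fun i => (c i : K))
      (blockForm (fun i => IsLocalRing.residue v.valuationSubring (a i))
        (fun i => IsLocalRing.residue v.valuationSubring (b i))
        fun i => IsLocalRing.residue v.valuationSubring (c i)) := by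
  intro x
  refine ⟨∑ i, (a i * x (Sum.inl i) ^ 2 + b i * (x (Sum.inl i) * x (Sum.inr i)) +
      c i * x (Sum.inr i) ^ 2), ?_, ?_⟩
  · simp [blockForm_apply]
  · simp [blockForm_apply]

lemma IsSumSq.exists_residue_eq {s : v.residueFieldK} (h : IsSumSq s) :
    ∃ S : v.valuationSubring, IsSumSq S ∧ IsLocalRing.residue v.valuationSubring S = s := by
  induction h with
  | zero => exact ⟨0, IsSumSq.zero, map_zero _⟩
  | @sq_add a s hs ih =>
    obtain ⟨S, hS, rfl⟩ := ih
    obtain ⟨A, rfl⟩ := IsLocalRing.residue_surjective a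
    exact ⟨A * A + S, IsSumSq.sq_add A hS, by simp⟩

lemma IsSumSq.coe_valuationSubring {S : v.valuationSubring} (h : IsSumSq S) :
    IsSumSq (S : K) := by
  induction h with
  | zero => exact IsSumSq.zero
  | sq_add a hs ih => exact IsSumSq.sq_add (a : K) ih

/-- If the residue field is nonreal, every binary form `aX² + bXY + cY²` over it with `a ≠ 0`
lifts to a form over the valuation ring whose discriminant is a sum of squares. -/
lemma exists_lift_discriminant_isSumSq (h : ¬ IsSemireal v.residueFieldK) {a : v.residueFieldK}
    (ha : a ≠ 0) (b c : v.residueFieldK) :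
    ∃ A B C : v.valuationSubring, IsLocalRing.residue v.valuationSubring A = a ∧
      IsLocalRing.residue v.valuationSubring B = b ∧
      IsLocalRing.residue v.valuationSubring C = c ∧ IsSumSq (B ^ 2 - 4 * A * C) := by
  obtain ⟨s, hs, hs0⟩ : ∃ s : v.residueFieldK, IsSumSq s ∧ 1 + s = 0 := by
    by_contra! hcon
    exact h ⟨fun hs => hcon _ hs⟩
  obtain ⟨S, hS, rfl⟩ := hs.exists_residue_eq
  obtain ⟨A, rfl⟩ := IsLocalRing.residue_surjective a
  obtain ⟨B, rfl⟩ := IsLocalRing.residue_surjective b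
  obtain ⟨C, rfl⟩ := IsLocalRing.residue_surjective c
  obtain ⟨A', hA'⟩ := ((IsLocalRing.residue_ne_zero_iff_isUnit A).1 ha).exists_right_inv
  -- With `μ = 1 + S` in the maximal ideal and `y = -AC`, the constant `C` may be changed by the
  -- multiple `μ (y² + 1) A⁻¹` of `μ`, which makes the discriminant large enough.
  refine ⟨A, B, C - (1 + S) * ((A * C) ^ 2 + 1) * A', rfl, rfl, ?_, ?_⟩
  · have : IsLocalRing.residue v.valuationSubring (1 + S) = 0 := by simpa using hs0
    rw [map_sub, map_mul, map_mul, this]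
    simp
  · have h1 : B ^ 2 - 4 * A * (C - (1 + S) * ((A * C) ^ 2 + 1) * A') =
        B * B + ((2 * (A * C) - 1) * (2 * (A * C) - 1) + (1 + 1 + 1 +
          (2 * 2) * (S * ((A * C) * (A * C) + 1)))) := by
      linear_combination 4 * (1 + S) * ((A * C) ^ 2 + 1) * hA'
    rw [h1]
    refine IsSumSq.sq_add _ (IsSumSq.sq_add _ ?_)
    refine ((IsSumSq.one.add IsSumSq.one).add IsSumSq.one).add ?_
    exact (IsSumSq.mul_self _).mul (hS.mul (IsSumSq.sq_add _ IsSumSq.one))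

end Lifting

/-! ### Torsion forms from sums of squares -/

section Pairs

variable {K V : Type*} [Field K] [AddCommGroup V] [Module K V]

lemma IsWeaklyMetabolic.of_pi {Q : QuadraticForm K V} {κ : Type*} [Fintype κ] [Nonempty κ]
    (h : IsWeaklyMetabolic (QuadraticMap.pi fun _ : κ => Q)) : IsWeaklyMetabolic Q := by
  obtain ⟨m, hm, h⟩ := h
  have : Nonempty (Fin m) := ⟨⟨0, hm⟩⟩
  refine IsWeaklyMetabolic.of_fintype (Fin m × κ)
    (h.of_linearEquiv (LinearEquiv.curry K V (Fin m) κ).symm fun x => ?_)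
  simp [orthogonalMultiple, QuadraticMap.pi_apply, Fintype.sum_prod_type]

/-- `Q ⟂ -S Q` is weakly metabolic if `S` is a sum of squares. -/
lemma QuadraticMap.Anisotropic.isWeaklyMetabolic_pair [FiniteDimensional K V]
    {Q : QuadraticForm K V} (hQ : Q.Anisotropic) (h2 : (2 : K) ≠ 0) {S : K} (hS : IsSumSq S) :
    IsWeaklyMetabolic (QuadraticMap.pi fun b : Bool => (bif b then 1 else -S) • Q) := by
  obtain ⟨w, hw, ⟨e⟩⟩ := hQ.exists_diagonalization h2 rfl
  have hWM : IsWeaklyMetabolic (blockForm w 0 fun i => -S * w i) := by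
    refine isWeaklyMetabolic_blockForm h2 hw fun i => ?_
    have : (0 : Fin (finrank K V) → K) i ^ 2 - 4 * w i * (-S * w i) =
        (2 * w i) * (2 * w i) * S := by
      simp only [Pi.zero_apply]
      ring
    rw [this]
    exact (IsSumSq.mul_self _).mul hS
  let f : (Fin (finrank K V) ⊕ Fin (finrank K V) → K) ≃ₗ[K] (Bool → V) :=
    { toFun := fun x b => e.symm.toLinearEquiv (bif b then x ∘ Sum.inl else x ∘ Sum.inr)
      invFun := fun y => Sum.elim (e.toLinearEquiv (y true)) (e.toLinearEquiv (y false))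
      map_add' := fun x y => by
        funext b
        cases b <;> exact map_add e.symm.toLinearEquiv _ _
      map_smul' := fun r x => by
        funext b
        cases b <;> exact map_smul e.symm.toLinearEquiv _ _
      left_inv := fun x => by
        funext i
        rcases i with i | i
        · exact congrFun (e.apply_symm_apply (x ∘ Sum.inl)) i
        · exact congrFun (e.apply_symm_apply (x ∘ Sum.inr)) i
      right_inv := fun y => by
        funext b
        cases b
        · exact e.symm_apply_apply (y false)
        · exact e.symm_apply_apply (y true) }
  refine hWM.of_linearEquiv f fun x => ?_
  have h1 : ∀ b, Q (f x b) = weightedSumSquares K w (bif b then x ∘ Sum.inl else x ∘ Sum.inr) :=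
    fun b => e.symm.map_app _
  rw [QuadraticMap.pi_apply, Fintype.sum_bool]
  simp only [_root_.smul_apply, h1, weightedSumSquares_apply, blockForm_apply, cond_true,
    cond_false, smul_eq_mul, one_mul, Finset.mul_sum, ← Finset.sum_add_distrib, Pi.zero_apply,
    Function.comp_apply]
  exact Finset.sum_congr rfl fun i _ => by ring

/-- Over a nonreal field of characteristic different from `2` every anisotropic form is torsion. -/
lemma QuadraticMap.Anisotropic.isWeaklyMetabolic [FiniteDimensional K V]
    {Q : QuadraticForm K V} (hQ : Q.Anisotropic) (h2 : (2 : K) ≠ 0) (hK : ¬ IsSemireal K) :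
    IsWeaklyMetabolic Q := by
  rw [isSemireal_iff_not_isSumSq_neg_one, not_not] at hK
  have h := hQ.isWeaklyMetabolic_pair h2 hK
  simp only [neg_neg, Bool.cond_self, one_smul] at h
  exact h.of_pi

end Pairs

/-! ### Cardinalities of groups and of sets of classes -/

section Index

lemma ENat.card_mul_le_of_forall_finset {G : Type*} {n u : ℕ∞}
    (h : ∀ s : Finset G, (s.card : ℕ∞) * n ≤ u) : ENat.card G * n ≤ u := by
  rcases finite_or_infinite G with hG | hG
  · have := Fintype.ofFinite G
    simpa [ENat.card_eq_coe_fintype_card] using h Finset.univ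
  · rcases eq_or_ne n 0 with rfl | hn
    · simp
    · have : u = ⊤ := by
        refine ENat.eq_top_iff_forall_ge.2 fun k => ?_
        obtain ⟨s, hs⟩ := Infinite.exists_subset_card_eq G k
        rw [← hs]
        exact (le_mul_of_one_le_right' (Order.one_le_iff_ne_zero.2 hn)).trans (h s)
      rw [this]
      exact le_top

/-- If `g ≠ 1` and `g² = 1`, every finite set is covered by a finite set `s` and its translate
`g s`, where `s` and `g s` are disjoint. -/
lemma exists_finset_disjoint_translate {G : Type*} [Group G] [DecidableEq G] {g : G} (hg : g ≠ 1)
    (hg2 : g * g = 1) (S : Finset G) :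
    ∃ s : Finset G, (∀ x ∈ s, g * x ∉ s) ∧ S.card ≤ 2 * s.card := by
  suffices H : ∃ s : Finset G, (∀ x ∈ s, g * x ∉ s) ∧ ∀ x ∈ S, x ∈ s ∨ g * x ∈ s by
    obtain ⟨s, hs, hS⟩ := H
    refine ⟨s, hs, ?_⟩
    have hsub : S ⊆ s ∪ s.image (g * ·) := by
      intro x hx
      rcases hS x hx with h | h
      · exact Finset.mem_union_left _ h
      · refine Finset.mem_union_right _ (Finset.mem_image.2 ⟨g * x, h, ?_⟩)
        simp [← mul_assoc, hg2]
    have h1 := Finset.card_le_card hsub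
    have h2 := Finset.card_union_le s (s.image (g * ·))
    have h3 : (s.image (g * ·)).card ≤ s.card := Finset.card_image_le
    omega
  induction S using Finset.induction_on with
  | empty => exact ⟨∅, by simp, by simp⟩
  | insert a S _ ih =>
    obtain ⟨s, hs, hS⟩ := ih
    by_cases ha : a ∈ s ∨ g * a ∈ s
    · exact ⟨s, hs, by simpa [ha] using hS⟩
    · push Not at ha
      refine ⟨insert a s, ?_, ?_⟩
      · intro x hx hgx
        rcases Finset.mem_insert.1 hx with rfl | hx
        · rcases Finset.mem_insert.1 hgx with h | h
          · exact hg (mul_eq_right.1 h)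
          · exact ha.2 h
        · rcases Finset.mem_insert.1 hgx with h | h
          · refine ha.2 ?_
            rw [← h, ← mul_assoc, hg2, one_mul]
            exact hx
          · exact hs x hx h
      · intro x hx
        rcases Finset.mem_insert.1 hx with rfl | hx
        · exact Or.inl (Finset.mem_insert_self _ _)
        · exact (hS x hx).imp Finset.mem_insert_of_mem Finset.mem_insert_of_mem

end Index

/-! ### Classes in `vK / 2vK` -/

namespace Valuation

variable {K : Type*} [Field K] {Γ₀ : Type*} [LinearOrderedCommGroupWithZero Γ₀]
  (v : Valuation K Γ₀)

/-- The class of `v a` in `vK / 2vK`. -/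
def valueClass : Kˣ →* v.valueGroupK ⧸ v.twoValueGroup :=
  (QuotientGroup.mk' v.twoValueGroup).comp v.unitsValue

lemma valueClass_surjective : Function.Surjective v.valueClass :=
  (QuotientGroup.mk'_surjective _).comp (MonoidHom.rangeRestrict_surjective _)

lemma valueClass_mul_self (a : Kˣ) : v.valueClass a * v.valueClass a = 1 := by
  rw [← map_mul]
  refine (QuotientGroup.eq_one_iff _).2 ⟨v.unitsValue a, ?_⟩
  rw [powMonoidHom_apply, _root_.sq, map_mul]

lemma valueClass_eq_of_valuation_eq {a b : Kˣ} {c : K} (hc : c ≠ 0)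
    (h : v a * v c ^ 2 = v b) : v.valueClass a = v.valueClass b := by
  have h1 : v.unitsValue (a * (Units.mk0 c hc * Units.mk0 c hc)) = v.unitsValue b := by
    refine Subtype.ext (Units.ext ?_)
    change v ((a : K) * (c * c)) = v b
    rw [map_mul, map_mul, ← _root_.sq, h]
  have h2 := congrArg (QuotientGroup.mk' v.twoValueGroup) h1
  change v.valueClass _ = v.valueClass b at h2
  rwa [map_mul, map_mul, valueClass_mul_self, mul_one] at h2

end Valuation

/-! ### Lower bounds for the `u`-invariant -/

section Bounds

variable {K : Type*} [Field K] {Γ₀ : Type*} [LinearOrderedCommGroupWithZero Γ₀]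
  {v : Valuation K Γ₀}

lemma ReducesTo.anisotropic {ι : Type*} [Fintype ι] {Q : QuadraticForm K (ι → K)}
    {q : QuadraticForm v.residueFieldK (ι → v.residueFieldK)}
    (h : ReducesTo v Q q) (hq : q.Anisotropic) : Q.Anisotropic := by
  have := anisotropic_of_pi (h.anisotropic_pi_smul (t := fun _ : Unit => (1 : Kˣ))
    (fun i j hij => absurd (Subsingleton.elim i j) hij) hq) ()
  simpa using this

/-- Orthogonal sums of multiples of `Q` over representatives of distinct classes of `vK / 2vK`
bound the `u`-invariant from below. -/
lemma card_mul_le_uInvariant_of_anisotropic {n : ℕ}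
    {q : QuadraticForm v.residueFieldK (Fin n → v.residueFieldK)} (hq : q.Anisotropic)
    (hK : (2 : K) = 0 ∨ ¬ IsSemireal K) (s : Finset (v.valueGroupK ⧸ v.twoValueGroup)) :
    (s.card : ℕ∞) * n ≤ uInvariant K := by
  obtain ⟨Q, hQ⟩ := exists_reducesTo q
  choose t ht using v.valueClass_surjective
  have ha := hQ.anisotropic_pi_smul (t := fun g : s => t g) (fun i j hij c hc h =>
    hij (Subtype.ext (by rw [← ht i, ← ht j, v.valueClass_eq_of_valuation_eq hc h]))) hq
  have hd : finrank K (s → Fin n → K) = s.card * n := by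
    simp [finrank_pi_fintype]
  rw [← Nat.cast_mul, ← hd]
  by_cases h2 : (2 : K) = 0
  · have : CharP K 2 := CharTwo.of_one_ne_zero_of_two_eq_zero one_ne_zero h2
    exact ha.finrank_le_uInvariant
  · exact (ha.isWeaklyMetabolic h2 (hK.resolve_left h2)).finrank_le_uInvariant h2 ha

/-- A sum of squares `S` with value outside `2vK` pairs the classes of `vK / 2vK`, and `Q ⟂ -S Q`
is torsion for every `Q`. -/
lemma card_mul_le_uInvariant_of_valueClass_ne_one {n : ℕ}
    {q : QuadraticForm v.residueFieldK (Fin n → v.residueFieldK)} (hq : q.Anisotropic)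
    (h2 : (2 : K) ≠ 0) {S : Kˣ} (hS : IsSumSq (S : K)) (hS1 : v.valueClass S ≠ 1)
    (s : Finset (v.valueGroupK ⧸ v.twoValueGroup)) :
    (s.card : ℕ∞) * n ≤ uInvariant K := by
  classical
  obtain ⟨s', hs', hcard⟩ :=
    exists_finset_disjoint_translate hS1 (v.valueClass_mul_self S) s
  obtain ⟨Q, hQ⟩ := exists_reducesTo q
  choose t ht using v.valueClass_surjective
  let t' : s' × Bool → Kˣ := fun p => t p.1 * bif p.2 then 1 else -S
  have hneg : v.valueClass (-S) = v.valueClass S := by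
    refine v.valueClass_eq_of_valuation_eq one_ne_zero ?_
    simp [v.map_neg]
  have ht' : ∀ p, v.valueClass (t' p) = (bif p.2 then 1 else v.valueClass S) * p.1 := by
    rintro ⟨g, b⟩
    cases b
    · simp only [t', cond_false, map_mul, ht, hneg, mul_comm]
    · simp only [t', cond_true, mul_one, one_mul, ht]
  have ha := hQ.anisotropic_pi_smul (t := t') (fun i j hij c hc h => by
    have h1 := v.valueClass_eq_of_valuation_eq hc h
    rw [ht', ht'] at h1
    obtain ⟨⟨g, hg⟩, b⟩ := i
    obtain ⟨⟨g', hg'⟩, b'⟩ := j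
    cases b <;> cases b' <;> simp only [cond_true, cond_false, one_mul] at h1
    · exact hij (by rw [Prod.mk.injEq, Subtype.mk.injEq]; exact ⟨mul_left_cancel h1, rfl⟩)
    · exact hs' g hg (h1 ▸ hg')
    · exact hs' g' hg' (h1 ▸ hg)
    · exact hij (by rw [Prod.mk.injEq, Subtype.mk.injEq]; exact ⟨h1, rfl⟩)) hq
  have hWM : IsWeaklyMetabolic (QuadraticMap.pi fun p => (t' p : K) • Q) := by
    refine (((hQ.anisotropic hq).isWeaklyMetabolic_pair h2 hS).pi_smul
      fun g : s' => (t g : K)).of_linearEquiv (LinearEquiv.curry K (Fin n → K) s' Bool).symm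
      fun x => ?_
    simp only [QuadraticMap.pi_apply, Fintype.sum_prod_type, _root_.smul_apply, Finset.smul_sum,
      smul_smul]
    refine Finset.sum_congr rfl fun g _ => Finset.sum_congr rfl fun b _ => ?_
    cases b <;> simp [t']
  have hle := hWM.finrank_le_uInvariant h2 ha
  refine le_trans ?_ hle
  have hd : finrank K (s' × Bool → Fin n → K) = 2 * s'.card * n := by
    simp [finrank_pi_fintype, mul_comm]
  rw [hd, ← Nat.cast_mul]
  exact_mod_cast Nat.mul_le_mul_right n hcard

/-- For a real residue field, a torsion form over it lifts only up to Witt equivalence; the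
anisotropic part of the resulting form over `K` is still large enough. -/
lemma card_mul_le_uInvariant_of_isSemireal [IsSemireal v.residueFieldK] {n : ℕ}
    {q : QuadraticForm v.residueFieldK (Fin n → v.residueFieldK)} (hq : q.Anisotropic)
    (hqt : IsTorsionForm q) (h2 : (2 : K) ≠ 0)
    (s : Finset (v.valueGroupK ⧸ v.twoValueGroup)) :
    (s.card : ℕ∞) * n ≤ uInvariant K := by
  have h2' : (2 : v.residueFieldK) ≠ 0 := IsSemireal.two_ne_zero
  obtain ⟨ι, _, a, d, ha, hd0, hd, hL⟩ :=
    exists_hasLagrangian_prod_blockForm n q hq (hqt.isWeaklyMetabolic h2')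
  choose A hA using fun i => IsLocalRing.residue_surjective (R := v.valuationSubring) (a i)
  choose D hDs hD using fun i => (hd i).exists_residue_eq
  have hns : IsNonsingular (blockForm a 0 (-(a * d))) :=
    isNonsingular_blockForm h2' ha fun i => neg_ne_zero.2 (mul_ne_zero (ha i) (hd0 i))
  have hT : ∀ T, IsTotallyIsotropic (blockForm a 0 (-(a * d))) T →
      2 * finrank v.residueFieldK T + n ≤ 2 * Fintype.card ι := by
    intro T hT
    have := hL.two_mul_finrank_add_le hq hns hT
    simp only [finrank_pi_fintype, finrank_self, Finset.sum_const, Finset.card_univ,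
      Fintype.card_sum, Fintype.card_fin, smul_eq_mul, mul_one] at this
    omega
  have hred := reducesTo_blockForm A 0 (-(A * D))
  have hres : (blockForm (fun i => IsLocalRing.residue v.valuationSubring (A i))
      (fun i => IsLocalRing.residue v.valuationSubring ((0 : ι → v.valuationSubring) i))
      fun i => IsLocalRing.residue v.valuationSubring ((-(A * D)) i)) =
      blockForm a 0 (-(a * d)) := by
    congr 1
    · exact funext hA
    · funext i
      change IsLocalRing.residue v.valuationSubring (-(A i * D i)) = -(a i * d i)
      rw [map_neg, map_mul, hA, hD]
  rw [hres] at hred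
  have hne : ∀ {x : v.valuationSubring}, IsLocalRing.residue v.valuationSubring x ≠ 0 →
      (x : K) ≠ 0 := by
    intro x hx h0
    have : x = 0 := Subtype.ext h0
    rw [this, map_zero] at hx
    exact hx rfl
  have hA0 : ∀ i, (A i : K) ≠ 0 := fun i => hne (by rw [hA]; exact ha i)
  have hD0 : ∀ i, (D i : K) ≠ 0 := fun i => hne (by rw [hD]; exact hd0 i)
  set Q := blockForm (fun i => (A i : K)) (fun i => (((0 : ι → v.valuationSubring) i :
    v.valuationSubring) : K)) fun i => (((-(A * D)) i : v.valuationSubring) : K) with hQ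
  have hQns : IsNonsingular Q :=
    isNonsingular_blockForm h2 hA0 fun i => by
      have : (((-(A * D)) i : v.valuationSubring) : K) = -((A i : K) * (D i : K)) := rfl
      rw [this]
      exact neg_ne_zero.2 (mul_ne_zero (hA0 i) (hD0 i))
  have hQWM : IsWeaklyMetabolic Q := by
    refine isWeaklyMetabolic_blockForm h2 hA0 fun i => ?_
    have : (((0 : ι → v.valuationSubring) i : v.valuationSubring) : K) ^ 2 -
        4 * (A i : K) * (((-(A * D)) i : v.valuationSubring) : K) =
        (2 * (A i : K)) * (2 * (A i : K)) * (D i : K) := by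
      simp
      ring
    rw [this]
    exact (IsSumSq.mul_self _).mul (hDs i).coe_valuationSubring
  choose t ht using v.valueClass_surjective
  obtain ⟨U, W, hU, hW, hortho, hperp, hdim, -, -⟩ := (hQns.pi_smul (ι := s)
    (t := fun g => (t g : K)) fun g => (t g).ne_zero).exists_anisotropic_part
  have hWWM := (hQWM.pi_smul fun g : s => (t g : K)).comp_subtype hU hortho hperp hdim
  -- No truncation occurs in `2 * card ι - n`, as `hT` for the zero subspace shows.
  have hUle := hred.finrank_le_of_isTotallyIsotropic (t := fun g : s => t g)
    (fun i j hij c hc h =>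
      hij (Subtype.ext (by rw [← ht i, ← ht j, v.valueClass_eq_of_valuation_eq hc h])))
    (r := (2 * Fintype.card ι - n) / 2) (fun T hT' => by have := hT T hT'; omega) hU
  refine le_trans ?_ (hWWM.finrank_le_uInvariant h2 hW)
  rw [← Nat.cast_mul, Nat.cast_le]
  have hn : n ≤ 2 * Fintype.card ι := by
    have := hT ⊥ fun x hx => by rw [(Submodule.mem_bot _).1 hx, QuadraticMap.map_zero]
    omega
  have hr : 2 * ((2 * Fintype.card ι - n) / 2) + n ≤ 2 * Fintype.card ι := by omega
  simp only [finrank_pi_fintype, finrank_self, Finset.sum_const, Finset.card_univ,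
    Fintype.card_sum, Fintype.card_coe, smul_eq_mul, mul_one] at hdim hUle
  have := Nat.mul_le_mul_left s.card hr
  nlinarith

/-- For a nonreal residue field, an anisotropic form over it lifts to a torsion form up to the loss
of one dimension, caused by the decomposition into binary forms. -/
lemma card_mul_le_uInvariant_of_not_isSemireal (hF : ¬ IsSemireal v.residueFieldK) {n : ℕ}
    {q : QuadraticForm v.residueFieldK (Fin n → v.residueFieldK)} (hq : q.Anisotropic)
    (h2 : (2 : K) ≠ 0) (s : Finset (v.valueGroupK ⧸ v.twoValueGroup)) :
    (s.card : ℕ∞) * (2 * (n / 2) : ℕ) ≤ uInvariant K := by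
  obtain ⟨a, b, c, hq'⟩ := hq.exists_anisotropic_blockForm (m := n / 2) (by
    rw [finrank_fin_fun]
    omega)
  have ha := hq'.blockForm_ne_zero
  choose A B C hA hB hC hABC using
    fun i => exists_lift_discriminant_isSumSq hF (ha i) (b i) (c i)
  have hred := reducesTo_blockForm A B C
  simp only [hA, hB, hC] at hred
  have hA0 : ∀ i, (A i : K) ≠ 0 := by
    intro i h0
    have : A i = 0 := Subtype.ext h0
    exact ha i (by rw [← hA, this, map_zero])
  have hWM := isWeaklyMetabolic_blockForm h2 hA0 (b := fun i => (B i : K))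
    (c := fun i => (C i : K)) fun i => (hABC i).coe_valuationSubring
  choose t ht using v.valueClass_surjective
  have han := hred.anisotropic_pi_smul (t := fun g : s => t g) (fun i j hij c hc h =>
    hij (Subtype.ext (by rw [← ht i, ← ht j, v.valueClass_eq_of_valuation_eq hc h]))) hq'
  refine le_trans (le_of_eq ?_)
    ((hWM.pi_smul fun g : s => (t g : K)).finrank_le_uInvariant h2 han)
  rw [← Nat.cast_mul]
  congr 1
  simp [finrank_pi_fintype, two_mul]

lemma indexTwo_mul_uInvariant_le
    (h : ∀ (n : ℕ) (q : QuadraticForm v.residueFieldK (Fin n → v.residueFieldK)), q.Anisotropic →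
      IsTorsionForm q → ∀ s : Finset (v.valueGroupK ⧸ v.twoValueGroup),
      (s.card : ℕ∞) * n ≤ uInvariant K) :
    v.indexTwo * uInvariant v.residueFieldK ≤ uInvariant K := by
  refine ENat.card_mul_le_of_forall_finset fun s => ?_
  rw [uInvariant, ENat.mul_iSup]
  refine iSup_le fun n => ?_
  rw [ENat.mul_iSup]
  exact iSup_le fun ⟨q, hq, hqt⟩ => h n q hq hqt s

lemma two_mul_floorHalf_le (u : ℕ∞) : 2 * floorHalf u ≤ u := by
  induction u with
  | top => exact le_top
  | coe n =>
    rw [floorHalf, ENat.map_natCast]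
    have := Nat.cast_le (α := ℕ∞).2 (Nat.mul_div_le n 2)
    rwa [Nat.cast_mul] at this

lemma two_mul_floorHalf_of_even {u : ℕ∞} (h : Even u) : 2 * floorHalf u = u := by
  induction u with
  | top => rfl
  | coe n =>
    obtain ⟨r, hr⟩ := h
    have hr' : r ≠ ⊤ := by
      rintro rfl
      exact ENat.natCast_ne_top n hr
    lift r to ℕ using hr'
    have hn : n = r + r := by exact_mod_cast hr
    have h2 : 2 * (n / 2) = n := by omega
    have := congrArg (Nat.cast (R := ℕ∞)) h2
    rw [floorHalf, ENat.map_natCast]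
    rwa [Nat.cast_mul] at this

/-- The hypothesis is monotone in `n`, so it extends from the dimensions of anisotropic torsion
forms to all `n ≤ u(Kv)`. -/
lemma indexTwo_mul_floorHalf_le
    (h : ∀ (n : ℕ) (q : QuadraticForm v.residueFieldK (Fin n → v.residueFieldK)), q.Anisotropic →
      ∀ s : Finset (v.valueGroupK ⧸ v.twoValueGroup),
      (s.card : ℕ∞) * (2 * (n / 2) : ℕ) ≤ uInvariant K) :
    v.indexTwo * (2 * floorHalf (uInvariant v.residueFieldK)) ≤ uInvariant K := by
  refine ENat.card_mul_le_of_forall_finset fun s => ?_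
  have key : ∀ k : ℕ, (k : ℕ∞) ≤ uInvariant v.residueFieldK →
      (s.card : ℕ∞) * (2 * (k / 2) : ℕ) ≤ uInvariant K := by
    intro k hk
    rcases k with _ | k
    · simp
    have hlt : (k : ℕ∞) < uInvariant v.residueFieldK :=
      (Nat.cast_lt.2 k.lt_succ_self).trans_le hk
    obtain ⟨n, hn⟩ := lt_iSup_iff.1 hlt
    obtain ⟨⟨q, hq, -⟩, hkn⟩ := lt_iSup_iff.1 hn
    have hkn' : k < n := Nat.cast_lt.1 hkn
    refine le_trans (mul_le_mul_right (Nat.cast_le.2 ?_) _) (h n q hq s)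
    omega
  generalize uInvariant v.residueFieldK = u at key
  induction u with
  | top =>
    rcases Nat.eq_zero_or_pos s.card with hs | hs
    · simp [hs]
    · have : uInvariant K = ⊤ := by
        refine ENat.eq_top_iff_forall_ge.2 fun k => (Nat.cast_le.2 ?_).trans
          ((Nat.cast_mul s.card (2 * (2 * k / 2))).le.trans (key (2 * k) le_top))
        have : 2 * (2 * k / 2) = 2 * k := by omega
        rw [this]
        nlinarith
      rw [this]
      exact le_top
  | coe n =>
    have := key n le_rfl
    rw [Nat.cast_mul] at this
    rwa [floorHalf, ENat.map_natCast]

end Bounds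

theorem proposition4 {K : Type*} [Field K] {Γ₀ : Type*} [LinearOrderedCommGroupWithZero Γ₀]
    (v : Valuation K Γ₀) :
    v.indexTwo * (2 * floorHalf (uInvariant v.residueFieldK)) ≤ uInvariant K ∧
    ((¬ IsSemireal K ∨
        IsSemireal v.residueFieldK ∨
        Even (uInvariant v.residueFieldK) ∨
        ¬ (v.unitsValue '' {x : Kˣ | IsSumSq (x : K)} ⊆ (v.twoValueGroup : Set v.valueGroupK))) →
      v.indexTwo * uInvariant v.residueFieldK ≤ uInvariant K) := by
  by_cases hK : (2 : K) = 0 ∨ ¬ IsSemireal K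
  · have h := indexTwo_mul_uInvariant_le (v := v)
      fun n q hq _ s => card_mul_le_uInvariant_of_anisotropic hq hK s
    exact ⟨(mul_le_mul_right (two_mul_floorHalf_le _) _).trans h, fun _ => h⟩
  push Not at hK
  obtain ⟨h2, hK⟩ := hK
  by_cases hF : IsSemireal v.residueFieldK
  · have h := indexTwo_mul_uInvariant_le (v := v)
      fun n q hq hqt s => card_mul_le_uInvariant_of_isSemireal hq hqt h2 s
    exact ⟨(mul_le_mul_right (two_mul_floorHalf_le _) _).trans h, fun _ => h⟩
  have h := indexTwo_mul_floorHalf_le (v := v)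
    fun n q hq s => card_mul_le_uInvariant_of_not_isSemireal hF hq h2 s
  refine ⟨h, ?_⟩
  rintro (h' | h' | h' | h')
  · exact absurd hK h'
  · exact absurd h' hF
  · rwa [two_mul_floorHalf_of_even h'] at h
  · obtain ⟨_, ⟨S, hS, rfl⟩, hS1⟩ := Set.not_subset.1 h'
    exact indexTwo_mul_uInvariant_le fun n q hq _ s =>
      card_mul_le_uInvariant_of_valueClass_ne_one hq h2 hS
        (fun h1 => hS1 ((QuotientGroup.eq_one_iff _).1 h1)) s
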